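/- Let $(\mathcal T,\otimes,\mathbb 1)$ be a compactly generated tensor triangulated category: $\mathcal T$ is a triangulated category with set-indexed coproducts, generated by a set of compact objects, with a symmetric monoidal structure that is compatible with the triangulation (exact in each variable, with the isomorphisms $\Sigma^nX\otimes Y\cong\Sigma^n(X\otimes Y)\cong X\otimes\Sigma^nY$ compatible, with the usual sign $(-1)^{mn}$, with unit, symmetry and associativity), the tensor product preserves set-indexed coproducts in each variable, and the unit $\mathbb 1$ is compact. Let $R$ be a $\mathbb Z$-graded, graded commutative noetherian ring of finite Krull dimension (the lengths of chains of homogeneous prime ideals are bounded), acting on $\mathcal T$ via a homomorphism of graded rings $R\to\operatorname{End}^*_{\mathcal T}(\mathbb 1)$, where $\operatorname{Hom}^n_{\mathcal T}(X,Y)=\operatorname{Hom}_{\mathcal T}(X,\Sigma^nY)$; thus $R$ acts on $\operatorname{Hom}^*_{\mathcal T}(X,Y)$ through $R\to\operatorname{End}^*_{\mathcal T}(\mathbb 1)\xrightarrow{-\otimes Y}\operatorname{End}^*_{\mathcal T}(Y)$. For a specialisation closed set $V$ of homogeneous primes, let $\mathcal T_V$ be the full subcategory of the objects $X$ with $\operatorname{Hom}^*_{\mathcal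 T}(C,X)_{\mathfrak q}=0$ for all compact $C$ and all $\mathfrak q\notin V$; let $\Gamma_V\colon\mathcal T\to\mathcal T$ be the inclusion of $\mathcal T_V$ composed with its right adjoint, and $L_V\colon\mathcal T\to\mathcal T$ the inclusion of $\{Y\mid\operatorname{Hom}_{\mathcal T}(X,Y)=0\text{ for all }X\in\mathcal T_V\}$ composed with its left adjoint. For a homogeneous prime $\mathfrak p$ put $\Gamma_{\mathfrak p}=\Gamma_{V(\mathfrak p)}L_{Z(\mathfrak p)}$ with $V(\mathfrak p)=\{\mathfrak q\mid\mathfrak p\subseteq\mathfrak q\}$ and $Z(\mathfrak p)=\{\mathfrak q\mid\mathfrak q\not\subseteq\mathfrak p\}$, and let $\Gamma_{\mathfrak p}\mathcal T=\{Y\mid Y\cong\Gamma_{\mathfrak p}X\text{ for some }X\in\mathcal T\}$. A localising subcategory is a (strictly) full triangulated subcategory closed under set-indexed coproducts; $\operatorname{Loc}_{\mathcal T}(X)$ is the smallest one containing $X$; a subcategory $\mathsf S$ is a tensor ideal of $\mathcal T$ if $X\otimes Y\in\mathsf S$ for all $X\in\mathsf S$, $Y\in\mathcal T$. Proposition. Let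 $\mathfrak p$ be a homogeneous prime ideal of $R$. The adjoints that define $\Gamma_{\mathfrak p}$ exist, and the following conditions are equivalent: 1. every object $X$ of $\mathcal T$ with $\operatorname{Hom}^*_{\mathcal T}(\mathbb 1,X)=0$ satisfies $\Gamma_{\mathfrak p}X=0$; 2. $\operatorname{Loc}_{\mathcal T}(\Gamma_{\mathfrak p}\mathbb 1)=\Gamma_{\mathfrak p}\mathcal T$; 3. every localising subcategory of $\mathcal T$ contained in $\Gamma_{\mathfrak p}\mathcal T$ is a tensor ideal of $\mathcal T$. -/

import Mathlib

open CategoryTheory Limits MonoidalCategory Pretriangulated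

universe v u w

/-! ### Localising subcategories and compact objects -/

namespace BIK

section Triangulated

variable {T : Type u} [Category.{v} T] [HasZeroObject T] [HasShift T ℤ] [Preadditive T]
  [∀ n : ℤ, (shiftFunctor T n).Additive] [Pretriangulated T]

/-- A localising subcategory: a (strictly) full triangulated subcategory closed under all
set-indexed coproducts. -/
structure IsLocalising (S : ObjectProperty T) : Prop where
  isTriangulated : S.IsTriangulated
  isClosedUnderIsomorphisms : S.IsClosedUnderIsomorphisms
  isClosedUnderCoproducts : ∀ J : Type v, S.IsClosedUnderColimitsOfShape (Discrete J)

/-- `Loc_T(C)`: the smallest localising subcategory containing the class `C` of objects. -/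
def loc (C : ObjectProperty T) : ObjectProperty T :=
  fun X => ∀ S : ObjectProperty T, IsLocalising S → C ≤ S → S X

end Triangulated

section Compact

/-- `C` is compact: `Hom(C, -)` preserves set-indexed coproducts. -/
def IsCompactObj {T : Type u} [Category.{v} T] [Preadditive T] (C : T) : Prop :=
  ∀ J : Type v,
    PreservesColimitsOfShape (Discrete J) (preadditiveCoyoneda.obj (Opposite.op C))

/-- `T` is generated by a set of compact objects: there is a set of compact objects such that an
object `X` with `Hom(G, X⟦n⟧) = 0` for all `n` and all `G` in the set is zero. (The existence of
set-indexed coproducts is a separate assumption.) -/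
def IsCompactlyGenerated (T : Type u) [Category.{v} T] [Preadditive T] [HasShift T ℤ] : Prop :=
  ∃ (ι : Type v) (G : ι → T), (∀ i, IsCompactObj (G i)) ∧
    ∀ X : T, (∀ (i : ι) (n : ℤ) (f : ShiftedHom (G i) X n), f = 0) → IsZero X

end Compact

/-! ### Tensor triangulated categories -/

section Tensor

variable (T : Type u) [Category.{v} T] [HasZeroObject T] [HasShift T ℤ] [Preadditive T]
  [∀ n : ℤ, (shiftFunctor T n).Additive] [Pretriangulated T]
  [MonoidalCategory T] [SymmetricCategory T] [(curriedTensor T).CommShift₂Int]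

variable {T} in
/-- The structural isomorphism `(Σⁿ X) ⊗ Y ≅ Σⁿ (X ⊗ Y)`. -/
noncomputable def shiftTensorIso (X Y : T) (n : ℤ) : X⟦n⟧ ⊗ Y ≅ (X ⊗ Y)⟦n⟧ :=
  ((tensorRight Y).commShiftIso n).app X

variable {T} in
/-- The structural isomorphism `X ⊗ (Σⁿ Y) ≅ Σⁿ (X ⊗ Y)`. -/
noncomputable def tensorShiftIso (X Y : T) (n : ℤ) : X ⊗ Y⟦n⟧ ≅ (X ⊗ Y)⟦n⟧ :=
  ((tensorLeft X).commShiftIso n).app Y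

/-- A triangulated category with a symmetric monoidal structure that is compatible with the
triangulation: the tensor product is exact in each variable, and the isomorphisms
`(Σⁿ X) ⊗ Y ≅ Σⁿ (X ⊗ Y)` and `X ⊗ (Σⁿ Y) ≅ Σⁿ (X ⊗ Y)`, which are natural in both variables and
for which the two identifications of `Σᵐ X ⊗ Σⁿ Y` with `Σᵐ⁺ⁿ (X ⊗ Y)` differ by `(-1) ^ (m * n)`
(this is `CommShift₂Int`), are compatible with the unit, the symmetry and the associativity
isomorphisms. -/
class IsTensorTriangulated : Prop where
  tensorLeft_exact (X : T) : (tensorLeft X).IsTriangulated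
  tensorRight_exact (X : T) : (tensorRight X).IsTriangulated
  leftUnitor_shift (X : T) (n : ℤ) :
    (tensorShiftIso (𝟙_ T) X n).hom ≫ (λ_ X).hom⟦n⟧' = (λ_ (X⟦n⟧)).hom
  braiding_shift (X Y : T) (n : ℤ) :
    (shiftTensorIso X Y n).hom ≫ (β_ X Y).hom⟦n⟧' =
      (β_ (X⟦n⟧) Y).hom ≫ (tensorShiftIso Y X n).hom
  associator_shift (X Y Z : T) (n : ℤ) :
    (shiftTensorIso X Y n).hom ▷ Z ≫ (shiftTensorIso (X ⊗ Y) Z n).hom ≫ (α_ X Y Z).hom⟦n⟧' =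
      (α_ (X⟦n⟧) Y Z).hom ≫ (shiftTensorIso X (Y ⊗ Z) n).hom

/-- A compactly generated tensor triangulated category: a tensor triangulated category with
set-indexed coproducts, generated by a set of compact objects, whose tensor product preserves
set-indexed coproducts in each variable and whose unit is compact. -/
class IsCompactlyGeneratedTensorTriangulated : Prop extends IsTensorTriangulated T where
  hasCoproducts : HasCoproducts.{v} T
  isCompactlyGenerated : IsCompactlyGenerated T
  tensorLeft_coproducts (X : T) (J : Type v) :
    PreservesColimitsOfShape (Discrete J) (tensorLeft X)
  tensorRight_coproducts (X : T) (J : Type v) :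
    PreservesColimitsOfShape (Discrete J) (tensorRight X)
  isCompactObj_unit : IsCompactObj (𝟙_ T)

variable {T} in
/-- `S` is a tensor ideal of `T`. (Closure under tensoring on the other side follows by
symmetry for subcategories closed under isomorphisms.) -/
def IsTensorIdeal (S : ObjectProperty T) : Prop :=
  ∀ X Y : T, S X → S (X ⊗ Y)

end Tensor

/-! ### Graded commutative rings and their homogeneous primes -/

section Graded

variable {R : Type w} [Ring R] (𝒜 : ℤ → AddSubgroup R) [GradedRing 𝒜]

/-- The `ℤ`-graded ring `R = ⨁ 𝒜 n` is graded commutative: `x y = (-1) ^ (|x| |y|) y x`. -/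
def IsGradedCommutative : Prop :=
  ∀ (m n : ℤ) (x y : R), x ∈ 𝒜 m → y ∈ 𝒜 n → x * y = ((m * n).negOnePow : ℤ) • (y * x)

/-- `Spec R`: the set of homogeneous prime ideals, ordered by inclusion. -/
abbrev HomogeneousSpec : Type w := {p : HomogeneousIdeal 𝒜 // p.toIdeal.IsPrime}

/-- `R` has finite Krull dimension: the lengths of chains of homogeneous primes are bounded. -/
def HasFiniteKrullDim : Prop := Order.krullDim (HomogeneousSpec 𝒜) < ⊤

variable {𝒜}

/-- `V(p) = {q | p ⊆ q}`. -/
def closedSet (p : HomogeneousSpec 𝒜) : Set (HomogeneousSpec 𝒜) :=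
  {q | p.1.toIdeal ≤ q.1.toIdeal}

/-- `Z(p) = {q | q ⊈ p}`. -/
def nonGeneralisations (p : HomogeneousSpec 𝒜) : Set (HomogeneousSpec 𝒜) :=
  {q | ¬ q.1.toIdeal ≤ p.1.toIdeal}

end Graded

/-! ### Actions of a graded ring through the tensor unit -/

section Action

variable {R : Type w} [Ring R] (𝒜 : ℤ → AddSubgroup R) [GradedRing 𝒜]
  (T : Type u) [Category.{v} T] [HasShift T ℤ] [Preadditive T]
  [∀ n : ℤ, (shiftFunctor T n).Additive] [MonoidalCategory T]

/-- A homomorphism of graded rings `R ⟶ End^*(𝟙)`, where `End^n(𝟙) = Hom(𝟙, Σⁿ 𝟙)` and the product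
of `f` in `End^m(𝟙)` and `g` in `End^n(𝟙)` is the composite `𝟙 ⟶ Σⁿ 𝟙 ⟶ Σᵐ⁺ⁿ 𝟙` of `g` and
`Σⁿ f`. -/
structure UnitAction where
  toHom (n : ℤ) : 𝒜 n →+ ShiftedHom (𝟙_ T) (𝟙_ T) n
  map_one : toHom 0 ⟨1, SetLike.GradedOne.one_mem⟩ = ShiftedHom.mk₀ 0 rfl (𝟙 (𝟙_ T))
  map_mul (m n : ℤ) (x : 𝒜 m) (y : 𝒜 n) :
    toHom (m + n) ⟨x * y, SetLike.GradedMul.mul_mem x.2 y.2⟩ =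
      (toHom n y).comp (toHom m x) rfl

end Action

section LocalCohomology

variable {R : Type w} [Ring R] {𝒜 : ℤ → AddSubgroup R} [GradedRing 𝒜]
  {T : Type u} [Category.{v} T] [HasZeroObject T] [HasShift T ℤ] [Preadditive T]
  [∀ n : ℤ, (shiftFunctor T n).Additive] [Pretriangulated T]
  [MonoidalCategory T] [SymmetricCategory T] [(curriedTensor T).CommShift₂Int]

/-- The image of `r` under `R ⟶ End^*(𝟙) ⟶ End^*(X)`, where the second map is `- ⊗ X`: the
composite `X ≅ 𝟙 ⊗ X ⟶ Σⁿ 𝟙 ⊗ X ≅ Σⁿ (𝟙 ⊗ X) ≅ Σⁿ X`. -/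
noncomputable def UnitAction.toEnd (φ : UnitAction 𝒜 T) (X : T) {n : ℤ} (r : 𝒜 n) :
    ShiftedHom X X n :=
  (λ_ X).inv ≫ φ.toHom n r ▷ X ≫ (shiftTensorIso (𝟙_ T) X n).hom ≫ (λ_ X).hom⟦n⟧'

/-- The action of `R` on `Hom^*(X, Y)`: `r • f` is the composite of `f : X ⟶ Σᵐ Y` with the image
of `r` in `End^n(Y)`. -/
noncomputable def UnitAction.smul (φ : UnitAction 𝒜 T) {X Y : T} {m n : ℤ} (r : 𝒜 n)
    (f : ShiftedHom X Y m) : ShiftedHom X Y (n + m) :=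
  f.comp (φ.toEnd Y r) rfl

/-- The localisation `Hom^*(X, Y)_q` of the graded `R`-module `Hom^*(X, Y)` at the homogeneous prime
`q` vanishes: each homogeneous element is annihilated by a homogeneous element of `R` outside
`q`. -/
def UnitAction.HomLocalisationVanishes (φ : UnitAction 𝒜 T) (X Y : T)
    (q : HomogeneousSpec 𝒜) : Prop :=
  ∀ (m : ℤ) (f : ShiftedHom X Y m), ∃ (n : ℤ) (r : 𝒜 n),
    (r : R) ∉ q.1.toIdeal ∧ φ.smul r f = 0

/-- For a specialisation closed set `V` of homogeneous primes, the localising subcategory `T_V` of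
`V`-torsion objects: those `X` with `Hom^*(C, X)_q = 0` for all compact `C` and all `q` not
in `V`. -/
def UnitAction.torsion (φ : UnitAction 𝒜 T) (V : Set (HomogeneousSpec 𝒜)) : ObjectProperty T :=
  fun X => ∀ C : T, IsCompactObj C → ∀ q ∉ V, φ.HomLocalisationVanishes C X q

/-- The subcategory of `V`-local objects: those receiving no nonzero morphism from a `V`-torsion
object. -/
def UnitAction.locals (φ : UnitAction 𝒜 T) (V : Set (HomogeneousSpec 𝒜)) : ObjectProperty T :=
  (φ.torsion V).rightOrthogonal

open Classical in
/-- The colocalisation functor `Γ_V : T ⥤ T` onto the `V`-torsion objects: the inclusion of `T_V`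
composed with its right adjoint (the identity, should there be no right adjoint). -/
noncomputable def UnitAction.gammaV (φ : UnitAction 𝒜 T) (V : Set (HomogeneousSpec 𝒜)) : T ⥤ T :=
  if h : (φ.torsion V).ι.IsLeftAdjoint then
    haveI := h
    (φ.torsion V).ι.rightAdjoint ⋙ (φ.torsion V).ι
  else 𝟭 T

open Classical in
/-- The localisation functor `L_V : T ⥤ T` with kernel `T_V`: the inclusion of the `V`-local objects
composed with its left adjoint (the identity, should there be no left adjoint). -/
noncomputable def UnitAction.locV (φ : UnitAction 𝒜 T) (V : Set (HomogeneousSpec 𝒜)) : T ⥤ T :=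
  if h : (φ.locals V).ι.IsRightAdjoint then
    haveI := h
    (φ.locals V).ι.leftAdjoint ⋙ (φ.locals V).ι
  else 𝟭 T

/-- The local cohomology functor `Γ_p = Γ_{V(p)} L_{Z(p)}`. -/
noncomputable def UnitAction.gamma (φ : UnitAction 𝒜 T) (p : HomogeneousSpec 𝒜) : T ⥤ T :=
  φ.locV (nonGeneralisations p) ⋙ φ.gammaV (closedSet p)

/-- The adjoints that define `Γ_p` exist. -/
def UnitAction.HasLocalCohomology (φ : UnitAction 𝒜 T) (p : HomogeneousSpec 𝒜) : Prop :=
  (φ.torsion (closedSet p)).ι.IsLeftAdjoint ∧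
    (φ.locals (nonGeneralisations p)).ι.IsRightAdjoint

/-- `Γ_p T`, the objects isomorphic to `Γ_p X` for some `X`. -/
def UnitAction.gammaT (φ : UnitAction 𝒜 T) (p : HomogeneousSpec 𝒜) : ObjectProperty T :=
  (φ.gamma p).essImage

end LocalCohomology

end BIK

/-! `Γ_p` is tensoring with a single object `E` of `Loc(𝟙)`. For a specialisation closed `V`,
Bousfield localisation of the unit at the Koszul objects of the primes in `V`
(`exists_triangle_locOf`) gives a triangle `Γ ⟶ 𝟙 ⟶ L ⟶` inside `Loc(𝟙)`; tensored with `X` it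
becomes, up to isomorphism, `Γ_V X ⟶ X ⟶ L_V X ⟶`.

Two facts make this work. First, Koszul objects are self-dual up to shift, in the weak form that
`Hom^*(K ⊗ A, Y)` and `Hom^*(A, K ⊗ Y)` vanish together (`Orth.of_koszul_left`, `Orth.koszul_left`);
hence they annihilate `L`. Second, they detect torsion objects (`isZero_of_torsion`): at a minimal
prime of the support of `Hom^*(G, Y)`, inverting one more element of the prime kills everything, so
the generators of the prime can be stripped off one at a time. Hence `L ⊗ X = 0` for torsion `X`.
The adjoints follow, and `Γ_p T` is the common kernel of two tensor functors: a localising tensor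
ideal on which `E ⊗ -` is isomorphic to the identity objectwise (`exists_gamma_iso`).

The equivalences are then formal, by repeated use of the fact that the `A` with `A ⊗ X` in a
localising subcategory form a localising subcategory. For 1 → 2, approximate `X` by an object of
`Loc(𝟙)`; the error is killed by `E`. For 2 → 3, write `X ⊗ Y ≅ X ⊗ (E ⊗ Y)` with `E ⊗ Y` in
`Loc(E)`. For 3 → 2, `X ≅ E ⊗ X` lies in the ideal `Loc(E)`. For 2 → 1, `E ⊗ X` lies in `Loc(𝟙)` and
receives nothing from `𝟙`. -/

open scoped ZeroObject

set_option linter.unusedSectionVars false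

namespace BIK

section Triangulated

variable {T : Type u} [Category.{v} T] [HasZeroObject T] [HasShift T ℤ] [Preadditive T]
  [∀ n : ℤ, (shiftFunctor T n).Additive] [Pretriangulated T]

/-! ### Exactness properties of distinguished triangles -/

section Exactness

variable {X Y Z : T} {f : X ⟶ Y} {g : Y ⟶ Z} {h : Z ⟶ X⟦(1 : ℤ)⟧}

lemma distTriang_comp₁₂ (H : Triangle.mk f g h ∈ distTriang T) : f ≫ g = 0 :=
  comp_distTriang_mor_zero₁₂ _ H

lemma distTriang_comp₃₁ (H : Triangle.mk f g h ∈ distTriang T) : h ≫ f⟦(1 : ℤ)⟧' = 0 :=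
  comp_distTriang_mor_zero₃₁ _ H

lemma distTriang_desc₂ (H : Triangle.mk f g h ∈ distTriang T) {W : T} (k : Y ⟶ W)
    (hk : f ≫ k = 0) : ∃ l : Z ⟶ W, k = g ≫ l :=
  Triangle.yoneda_exact₂ _ H k hk

lemma distTriang_desc₃ (H : Triangle.mk f g h ∈ distTriang T) {W : T} (k : Z ⟶ W)
    (hk : g ≫ k = 0) : ∃ l : X⟦(1 : ℤ)⟧ ⟶ W, k = h ≫ l :=
  Triangle.yoneda_exact₃ _ H k hk

lemma distTriang_lift₂ (H : Triangle.mk f g h ∈ distTriang T) {W : T} (k : W ⟶ Y)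
    (hk : k ≫ g = 0) : ∃ l : W ⟶ X, k = l ≫ f :=
  Triangle.coyoneda_exact₂ _ H k hk

lemma distTriang_lift₃ (H : Triangle.mk f g h ∈ distTriang T) {W : T} (k : W ⟶ Z)
    (hk : k ≫ h = 0) : ∃ l : W ⟶ Y, k = l ≫ g :=
  Triangle.coyoneda_exact₃ _ H k hk

lemma distTriang_lift₁ (H : Triangle.mk f g h ∈ distTriang T) {W : T} (k : W ⟶ X⟦(1 : ℤ)⟧)
    (hk : k ≫ f⟦(1 : ℤ)⟧' = 0) : ∃ l : W ⟶ Z, k = l ≫ h :=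
  Triangle.coyoneda_exact₁ _ H k hk

lemma distTriang_desc₁ (H : Triangle.mk f g h ∈ distTriang T) {W : T} (k : X ⟶ W)
    (hk : h ≫ k⟦(1 : ℤ)⟧' = 0) : ∃ l : Y ⟶ W, k = f ≫ l := by
  -- Exactness of the twice rotated triangle; rotation puts a sign on `f⟦1⟧`, which the witness
  -- `-l'` absorbs.
  obtain ⟨l, hl⟩ : ∃ l : Y⟦(1 : ℤ)⟧ ⟶ W⟦(1 : ℤ)⟧, k⟦(1 : ℤ)⟧' = (-f⟦(1 : ℤ)⟧') ≫ l :=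
    Triangle.yoneda_exact₂ _ (rot_of_distTriang _ (rot_of_distTriang _ H)) _ hk
  obtain ⟨l', rfl⟩ := (shiftFunctor T (1 : ℤ)).map_surjective l
  refine ⟨-l', (shiftFunctor T (1 : ℤ)).map_injective ?_⟩
  rw [hl, Preadditive.comp_neg, Functor.map_neg, Functor.map_comp, Preadditive.neg_comp]

end Exactness

/-! ### Localising subcategories -/

namespace IsLocalising

variable {S : ObjectProperty T}

lemma of_iso (hS : IsLocalising S) {X Y : T} (e : X ≅ Y) (hX : S X) : S Y :=
  hS.isClosedUnderIsomorphisms.of_iso e hX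

lemma zero (hS : IsLocalising S) {X : T} (hX : IsZero X) : S X := by
  have := hS.isTriangulated
  obtain ⟨Z, hZ, h⟩ := S.exists_prop_of_containsZero
  exact hS.of_iso (hZ.iso hX) h

lemma shift (hS : IsLocalising S) {X : T} (hX : S X) (n : ℤ) : S (X⟦n⟧) := by
  have := hS.isTriangulated
  exact S.le_shift n X hX

lemma ext₂ (hS : IsLocalising S) {A : Triangle T} (hA : A ∈ distTriang T) (h₁ : S A.obj₁)
    (h₃ : S A.obj₃) : S A.obj₂ := by
  have := hS.isTriangulated
  have := hS.isClosedUnderIsomorphisms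
  exact S.ext_of_isTriangulatedClosed₂ A hA h₁ h₃

lemma ext₃ (hS : IsLocalising S) {A : Triangle T} (hA : A ∈ distTriang T) (h₁ : S A.obj₁)
    (h₂ : S A.obj₂) : S A.obj₃ := by
  have := hS.isTriangulated
  have := hS.isClosedUnderIsomorphisms
  exact S.ext_of_isTriangulatedClosed₃ A hA h₁ h₂

lemma sigma (hS : IsLocalising S) {J : Type v} (X : J → T) [HasCoproduct X]
    (hX : ∀ j, S (X j)) : S (∐ X) := by
  have := hS.isClosedUnderCoproducts J
  exact S.prop_colimit _ fun j => hX j.as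

/-- A criterion for being localising. -/
lemma mk' [HasCoproducts.{v} T] (iso : ∀ ⦃X Y : T⦄, (X ≅ Y) → S X → S Y)
    (zero : ∀ ⦃X : T⦄, IsZero X → S X) (shift : ∀ ⦃X : T⦄ (n : ℤ), S X → S (X⟦n⟧))
    (ext₂ : ∀ A ∈ distTriang T, S A.obj₁ → S A.obj₃ → S A.obj₂)
    (sigma : ∀ (J : Type v) (X : J → T), (∀ j, S (X j)) → S (∐ X)) : IsLocalising S := by
  have : S.IsClosedUnderIsomorphisms := ⟨fun e h => iso e h⟩
  refine ⟨?_, this, fun J => ?_⟩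
  · exact
      { exists_zero := ⟨0, isZero_zero T, zero (isZero_zero T)⟩
        isStableUnderShiftBy := fun n => ⟨fun X hX => shift n hX⟩
        ext₂' := fun A hA h₁ h₃ => S.le_isoClosure _ (ext₂ A hA h₁ h₃) }
  · refine .mk' ?_
    rintro _ ⟨F, hF⟩
    exact iso (HasColimit.isoOfNatIso Discrete.natIsoFunctor).symm (sigma J _ fun j => hF ⟨j⟩)

lemma inf {S' : ObjectProperty T} (hS : IsLocalising S) (hS' : IsLocalising S')
    [HasCoproducts.{v} T] : IsLocalising (S ⊓ S') :=
  mk' (fun _ _ e h => ⟨hS.of_iso e h.1, hS'.of_iso e h.2⟩) (fun _ h => ⟨hS.zero h, hS'.zero h⟩)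
    (fun _ n h => ⟨hS.shift h.1 n, hS'.shift h.2 n⟩)
    (fun _ hA h₁ h₃ => ⟨hS.ext₂ hA h₁.1 h₃.1, hS'.ext₂ hA h₁.2 h₃.2⟩)
    (fun _ X h => ⟨hS.sigma X fun j => (h j).1, hS'.sigma X fun j => (h j).2⟩)

/-- Being zero is a localising property. -/
lemma isZero [HasCoproducts.{v} T] : IsLocalising (fun X : T => IsZero X) :=
  mk' (fun _ _ e h => h.of_iso e.symm) (fun _ h => h)
    (fun _ n h => (shiftFunctor T n).map_isZero h)
    (fun A hA h₁ h₃ => Triangle.isZero₂_of_isZero₁₃ A hA h₁ h₃)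
    (fun J X h => by
      rw [IsZero.iff_id_eq_zero]
      exact Sigma.hom_ext _ _ fun j => (h j).eq_of_src _ _)

/-- The preimage of a localising subcategory under an exact functor preserving coproducts. -/
lemma inverseImage (hS : IsLocalising S) (F : T ⥤ T) [F.CommShift ℤ] [F.IsTriangulated]
    (hF : ∀ J : Type v, PreservesColimitsOfShape (Discrete J) F) :
    IsLocalising (S.inverseImage F) := by
  have := hS.isClosedUnderIsomorphisms
  have := hS.isTriangulated
  refine ⟨?_, inferInstance, fun J => ?_⟩
  · exact
      { exists_zero := ⟨0, isZero_zero T, hS.zero (F.map_isZero (isZero_zero T))⟩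
        isStableUnderShiftBy := fun n =>
          ⟨fun X hX => hS.of_iso ((F.commShiftIso n).app X).symm (hS.shift hX n)⟩
        ext₂' := fun A hA h₁ h₃ =>
          ObjectProperty.le_isoClosure _ _ (hS.ext₂ (F.map_distinguished A hA) h₁ h₃) }
  · have := hS.isClosedUnderCoproducts J
    have := hF J
    infer_instance

end IsLocalising

lemma subset_loc (C : ObjectProperty T) : C ≤ loc C := fun X hX _ _ hC => hC X hX

lemma loc_le {C S : ObjectProperty T} (hS : IsLocalising S) (h : C ≤ S) : loc C ≤ S :=
  fun _ hX => hX S hS h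

lemma isLocalising_loc [HasCoproducts.{v} T] (C : ObjectProperty T) : IsLocalising (loc C) :=
  .mk' (fun _ _ e h S hS hC => hS.of_iso e (h S hS hC)) (fun _ h _ hS _ => hS.zero h)
    (fun _ n h S hS hC => hS.shift (h S hS hC) n)
    (fun _ hA h₁ h₃ S hS hC => hS.ext₂ hA (h₁ S hS hC) (h₃ S hS hC))
    (fun _ X h S hS hC => hS.sigma X fun j => h j S hS hC)

/-- Membership in the localising subcategory generated by one object. -/
lemma loc_singleton_le {S : ObjectProperty T} (hS : IsLocalising S) {X : T} (hX : S X) :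
    loc (ObjectProperty.singleton X) ≤ S :=
  loc_le hS (by rintro _ ⟨⟩; exact hX)

/-! ### Orthogonality -/

/-- There are no nonzero graded morphisms from `A` to `Y`. -/
def Orth (A Y : T) : Prop := ∀ (n : ℤ) (f : A ⟶ Y⟦n⟧), f = 0

namespace Orth

variable {A B Y Z : T}

lemma of_iso_left (h : Orth A Y) (e : A ≅ B) : Orth B Y := fun n f => by
  rw [← cancel_epi e.hom, h n (e.hom ≫ f), comp_zero]

lemma of_iso_right (h : Orth A Y) (e : Y ≅ Z) : Orth A Z := fun n f => by
  rw [← cancel_mono ((shiftFunctor T n).mapIso e.symm).hom]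
  -- Both sides are now graded morphisms from `A` to `Y`, so each of them vanishes.
  exact (h _ _).trans (h _ _).symm

lemma shift_left (h : Orth A Y) (m : ℤ) : Orth (A⟦m⟧) Y := fun n f => by
  apply (shiftFunctor T (-m)).map_injective
  rw [← cancel_epi ((shiftFunctorCompIsoId T m (-m) (by simp)).inv.app A),
    ← cancel_mono ((shiftFunctorAdd T n (-m)).inv.app Y)]
  exact (h _ _).trans (h _ _).symm

lemma shift_right (h : Orth A Y) (m : ℤ) : Orth A (Y⟦m⟧) := fun n f => by
  rw [← cancel_mono ((shiftFunctorAdd T m n).inv.app Y)]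
  exact (h _ _).trans (h _ _).symm

lemma eq_zero (h : Orth A Y) (f : A ⟶ Y) : f = 0 := by
  rw [← cancel_mono ((shiftFunctorZero T ℤ).inv.app Y)]
  exact (h 0 _).trans (h 0 _).symm

end Orth

lemma orth_of_forall_shift_left {A Y : T} (h : ∀ (n : ℤ) (f : A⟦n⟧ ⟶ Y), f = 0) : Orth A Y :=
  fun n f => by
    apply (shiftFunctor T (-n)).map_injective
    rw [← cancel_mono ((shiftFunctorCompIsoId T n (-n) (by simp)).hom.app Y)]
    exact (h _ _).trans (h _ _).symm

/-- The objects left orthogonal to a given object form a localising subcategory. -/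
lemma isLocalising_orth_left [HasCoproducts.{v} T] (Y : T) :
    IsLocalising (fun A : T => Orth A Y) := by
  refine .mk' (fun A B e h => h.of_iso_left e) (fun A hA n f => hA.eq_of_src _ _)
    (fun A m h => h.shift_left m) (fun A hA h₁ h₃ n f => ?_) (fun J X h n f => ?_)
  · obtain ⟨g, rfl⟩ := Triangle.yoneda_exact₂ A hA f (h₁ n _)
    rw [h₃ n g, comp_zero]
  · exact Sigma.hom_ext _ _ fun j => (h j n _).trans (h j n _).symm

end Triangulated

section Finitary

/-! ### Finitary objects -/

variable {T : Type u} [Category.{v} T] [Preadditive T] [HasCoproducts.{v} T]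

open Classical in
/-- The endomorphism of a coproduct that annihilates the summands indexed by `s` and is the
identity on the others. -/
noncomputable def sigmaTrunc {J : Type v} (X : J → T) (s : Finset J) : ∐ X ⟶ ∐ X :=
  Sigma.desc fun j => if j ∈ s then 0 else Sigma.ι X j

open Classical in
/-- The projection of a coproduct onto a summand. -/
noncomputable def sigmaProj {J : Type v} (X : J → T) (j : J) : ∐ X ⟶ X j :=
  Sigma.desc fun i => if h : i = j then eqToHom (congrArg X h) else 0

section

variable {J : Type v} (X : J → T)

lemma ι_sigmaTrunc_of_mem {s : Finset J} {j : J} (h : j ∈ s) :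
    Sigma.ι X j ≫ sigmaTrunc X s = 0 := by
  simp [sigmaTrunc, h]

lemma ι_sigmaTrunc_of_notMem {s : Finset J} {j : J} (h : j ∉ s) :
    Sigma.ι X j ≫ sigmaTrunc X s = Sigma.ι X j := by
  simp [sigmaTrunc, h]

lemma ι_sigmaProj_self (j : J) : Sigma.ι X j ≫ sigmaProj X j = 𝟙 _ := by
  simp [sigmaProj]

lemma ι_sigmaProj_of_ne {i j : J} (h : i ≠ j) : Sigma.ι X i ≫ sigmaProj X j = 0 := by
  simp [sigmaProj, h]

open Classical in
lemma sigmaTrunc_comp (s t : Finset J) :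
    sigmaTrunc X s ≫ sigmaTrunc X t = sigmaTrunc X (s ∪ t) := by
  refine Sigma.hom_ext _ _ fun j => ?_
  by_cases hs : j ∈ s
  · rw [← Category.assoc, ι_sigmaTrunc_of_mem X hs, zero_comp,
      ι_sigmaTrunc_of_mem X (Finset.mem_union_left t hs)]
  · rw [← Category.assoc, ι_sigmaTrunc_of_notMem X hs]
    by_cases ht : j ∈ t
    · rw [ι_sigmaTrunc_of_mem X ht, ι_sigmaTrunc_of_mem X (Finset.mem_union_right s ht)]
    · rw [ι_sigmaTrunc_of_notMem X ht, ι_sigmaTrunc_of_notMem X (by simp [hs, ht])]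

lemma sigmaTrunc_add_sum (s : Finset J) :
    sigmaTrunc X s + ∑ j ∈ s, sigmaProj X j ≫ Sigma.ι X j = 𝟙 (∐ X) := by
  refine Sigma.hom_ext _ _ fun j => ?_
  rw [Preadditive.comp_add, Preadditive.comp_sum, Category.comp_id]
  by_cases hs : j ∈ s
  · rw [ι_sigmaTrunc_of_mem X hs, zero_add, Finset.sum_eq_single_of_mem j hs, ← Category.assoc,
      ι_sigmaProj_self, Category.id_comp]
    intro i _ hij
    rw [← Category.assoc, ι_sigmaProj_of_ne X hij.symm, zero_comp]
  · rw [ι_sigmaTrunc_of_notMem X hs, Finset.sum_eq_zero, add_zero]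
    intro i hi
    rw [← Category.assoc, ι_sigmaProj_of_ne X (by rintro rfl; exact hs hi), zero_comp]

end

/-- Every morphism from `C` to a set-indexed coproduct factors through finitely many summands. -/
def IsFinitary (C : T) : Prop :=
  ∀ (J : Type v) (X : J → T) (f : C ⟶ ∐ X), ∃ s : Finset J, f ≫ sigmaTrunc X s = 0

lemma eq_sum_of_comp_sigmaTrunc_eq_zero {C : T} {J : Type v} {X : J → T} {f : C ⟶ ∐ X}
    {s : Finset J} (h : f ≫ sigmaTrunc X s = 0) :
    f = ∑ j ∈ s, (f ≫ sigmaProj X j) ≫ Sigma.ι X j := by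
  conv_lhs => rw [← Category.comp_id f, ← sigmaTrunc_add_sum X s, Preadditive.comp_add, h,
    zero_add, Preadditive.comp_sum]
  simp only [Category.assoc]

/-- The morphisms that factor through finitely many summands form a subgroup `H`. The quotient map
by `H` vanishes on each `Hom(C, X j)`, hence on their coproduct, which is `Hom(C, ∐ X)` by
compactness. -/
lemma IsCompactObj.isFinitary {C : T} (hC : IsCompactObj C) : IsFinitary C := by
  classical
  intro J X f
  have := hC J
  let F := preadditiveCoyoneda.obj (Opposite.op C)
  let hF := isColimitCofanMkObjOfIsColimit F X _ (coproductIsCoproduct X)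
  let H : AddSubgroup (C ⟶ ∐ X) :=
    { carrier := {g | ∃ s : Finset J, g ≫ sigmaTrunc X s = 0}
      zero_mem' := ⟨∅, zero_comp⟩
      add_mem' := by
        rintro a b ⟨s, hs⟩ ⟨t, ht⟩
        refine ⟨s ∪ t, ?_⟩
        rw [Preadditive.add_comp, ← sigmaTrunc_comp, ← Category.assoc, hs, zero_comp, zero_add,
          sigmaTrunc_comp, Finset.union_comm, ← sigmaTrunc_comp, ← Category.assoc, ht, zero_comp]
      neg_mem' := by
        rintro a ⟨s, hs⟩
        exact ⟨s, by rw [Preadditive.neg_comp, hs, neg_zero]⟩ }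
  let q : F.obj (∐ X) ⟶ AddCommGrpCat.of ((C ⟶ ∐ X) ⧸ H) :=
    AddCommGrpCat.ofHom (QuotientAddGroup.mk' H)
  have hι (j : J) (g : C ⟶ X j) : (g ≫ Sigma.ι X j) ≫ sigmaTrunc X {j} = 0 := by
    rw [Category.assoc, ι_sigmaTrunc_of_mem X (Finset.mem_singleton_self j), comp_zero]
  have hq : q = 0 := by
    refine Cofan.IsColimit.hom_ext hF _ _ fun j => ?_
    ext g
    refine (QuotientAddGroup.eq_zero_iff (N := H) (g ≫ Sigma.ι X j)).2 ⟨{j}, ?_⟩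
    exact hι j g
  exact (QuotientAddGroup.eq_zero_iff (N := H) f).1 (ConcreteCategory.congr_hom hq f)

lemma IsFinitary.of_iso {C D : T} (e : C ≅ D) (hC : IsFinitary C) : IsFinitary D := by
  intro J X f
  obtain ⟨s, hs⟩ := hC J X (e.hom ≫ f)
  exact ⟨s, by rw [← cancel_epi e.hom, ← Category.assoc, hs, comp_zero]⟩

lemma IsFinitary.shift [HasShift T ℤ] [∀ n : ℤ, (shiftFunctor T n).Additive] {C : T}
    (hC : IsFinitary C) (n : ℤ) : IsFinitary (C⟦n⟧) := by
  intro J X f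
  let c := sigmaComparison (shiftFunctor T (-n)) X
  let u := (shiftFunctorCompIsoId T n (-n) (by simp)).inv.app C
  have hc (s : Finset J) : sigmaTrunc _ s ≫ c = c ≫ (sigmaTrunc X s)⟦-n⟧' := by
    refine Sigma.hom_ext _ _ fun j => ?_
    simp only [c, ι_comp_sigmaComparison_assoc, ← Functor.map_comp]
    by_cases hs : j ∈ s
    · rw [ι_sigmaTrunc_of_mem X hs, ← Category.assoc, ι_sigmaTrunc_of_mem _ hs, zero_comp,
        Functor.map_zero]
    · rw [ι_sigmaTrunc_of_notMem X hs, ← Category.assoc, ι_sigmaTrunc_of_notMem _ hs,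
        ι_comp_sigmaComparison]
  obtain ⟨s, hs⟩ := hC J _ (u ≫ f⟦-n⟧' ≫ inv c)
  refine ⟨s, (shiftFunctor T (-n)).map_injective ?_⟩
  have h := hs =≫ c
  rw [zero_comp, Category.assoc, hc, Category.assoc, Category.assoc, IsIso.inv_hom_id_assoc,
    ← Functor.map_comp] at h
  rw [← cancel_epi u, Functor.map_zero, comp_zero]
  exact h

section Triangulated

variable [HasZeroObject T] [HasShift T ℤ] [∀ n : ℤ, (shiftFunctor T n).Additive]
  [Pretriangulated T]

/-- Two truncations in succession: one makes `f` factor through the shift of the first object, the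
other kills the remaining factor. -/
lemma IsFinitary.ext₃ {A : Triangle T} (hA : A ∈ distTriang T) (h₁ : IsFinitary A.obj₁)
    (h₂ : IsFinitary A.obj₂) : IsFinitary A.obj₃ := by
  classical
  intro J X f
  obtain ⟨s, hs⟩ := h₂ J X (A.mor₂ ≫ f)
  obtain ⟨g, hg⟩ := Triangle.yoneda_exact₃ A hA (f ≫ sigmaTrunc X s) (by rw [← hs, Category.assoc])
  obtain ⟨t, ht⟩ := h₁.shift 1 J X g
  exact ⟨s ∪ t, by rw [← sigmaTrunc_comp, ← Category.assoc, hg, Category.assoc, ht, comp_zero]⟩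

/-- If `C` is finitary, then the objects receiving no nonzero graded morphism from `C` form a
localising subcategory. -/
lemma isLocalising_orth_right {C : T} (hC : IsFinitary C) :
    IsLocalising (fun Y : T => Orth C Y) := by
  refine .mk' (fun A B e h => h.of_iso_right e)
    (fun A hA n f => ((shiftFunctor T n).map_isZero hA).eq_of_tgt _ _)
    (fun A m h => h.shift_right m) (fun A hA h₁ h₃ n f => ?_) (fun J X h n f => ?_)
  · obtain ⟨g, rfl⟩ := Triangle.coyoneda_exact₂ _ (A.shift_distinguished hA n) f (h₃ n _)
    exact (congrArg (· ≫ _) (h₁ n g)).trans zero_comp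
  · let c := sigmaComparison (shiftFunctor T n) X
    obtain ⟨s, hs⟩ := hC J _ (f ≫ inv c)
    rw [← cancel_mono (inv c), eq_sum_of_comp_sigmaTrunc_eq_zero hs, zero_comp]
    refine Finset.sum_eq_zero fun j _ => ?_
    rw [h j n ((f ≫ inv c) ≫ sigmaProj _ j), zero_comp]

end Triangulated

end Finitary

section Telescope

/-! ### Telescopes -/

variable {T : Type u} [Category.{v} T] [Preadditive T] [HasCoproducts.{v} T]
  (A : ℕ → T) (a : ∀ k, A k ⟶ A (k + 1))

/-- The coproduct of a sequence of objects. -/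
noncomputable abbrev seqSigma : T := ∐ fun j : ULift.{v} ℕ => A j.down

/-- The inclusion of a term in the coproduct of a sequence. -/
noncomputable abbrev seqι (k : ℕ) : A k ⟶ seqSigma A :=
  Sigma.ι (fun j : ULift.{v} ℕ => A j.down) ⟨k⟩

/-- The projection of the coproduct of a sequence onto a term. -/
noncomputable abbrev seqProj (k : ℕ) : seqSigma A ⟶ A k :=
  sigmaProj (fun j : ULift.{v} ℕ => A j.down) ⟨k⟩

variable {A}

lemma seqSigma_hom_ext {Z : T} {f g : seqSigma A ⟶ Z} (h : ∀ k, seqι A k ≫ f = seqι A k ≫ g) :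
    f = g :=
  Sigma.hom_ext _ _ fun j => h j.down

/-- The endomorphism of the coproduct of a sequence induced by the transition maps. -/
noncomputable def seqShift : seqSigma A ⟶ seqSigma A :=
  Sigma.desc fun j => a j.down ≫ seqι A (j.down + 1)

lemma seqι_seqShift (k : ℕ) : seqι A k ≫ seqShift a = a k ≫ seqι A (k + 1) := by
  simp [seqShift, seqι]

lemma seqShift_seqProj_zero : seqShift a ≫ seqProj A 0 = 0 := by
  refine seqSigma_hom_ext fun k => ?_
  rw [← Category.assoc, seqι_seqShift, Category.assoc, comp_zero,
    ι_sigmaProj_of_ne _ (by simp), comp_zero]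

lemma seqShift_seqProj_succ (k : ℕ) : seqShift a ≫ seqProj A (k + 1) = seqProj A k ≫ a k := by
  refine seqSigma_hom_ext fun j => ?_
  rw [← Category.assoc, seqι_seqShift, Category.assoc, ← Category.assoc (seqι A j)]
  by_cases h : j = k
  · subst h
    rw [ι_sigmaProj_self, ι_sigmaProj_self, Category.comp_id, Category.id_comp]
  · rw [ι_sigmaProj_of_ne _ (by simpa using h), ι_sigmaProj_of_ne _ (by simpa using h), comp_zero,
      zero_comp]

/-- A morphism fixed by the shift has zeroth component zero, and each component determines the next;
a finitary source sees only finitely many of them. This is injectivity of `1 - shift` on morphisms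
from `C`. -/
lemma eq_zero_of_comp_seqShift {C : T} (hC : IsFinitary C) {g : C ⟶ seqSigma A}
    (h : g ≫ seqShift a = g) : g = 0 := by
  have key (k : ℕ) : g ≫ seqProj A k = 0 := by
    induction k with
    | zero => rw [← h, Category.assoc, seqShift_seqProj_zero, comp_zero]
    | succ k ih => rw [← h, Category.assoc, seqShift_seqProj_succ, ← Category.assoc, ih, zero_comp]
  obtain ⟨s, hs⟩ := hC _ _ g
  rw [eq_sum_of_comp_sigmaTrunc_eq_zero hs]
  exact Finset.sum_eq_zero fun j _ => by rw [key j.down, zero_comp]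

variable {a} in
lemma exists_lift_seqι {H : T} {q : seqSigma A ⟶ H} (hq : seqShift a ≫ q = q) {C : T} {k m : ℕ}
    (hkm : k ≤ m) (g : C ⟶ A k) : ∃ g' : C ⟶ A m, g ≫ seqι A k ≫ q = g' ≫ seqι A m ≫ q := by
  induction m, hkm using Nat.le_induction with
  | base => exact ⟨g, rfl⟩
  | succ m _ ih =>
    obtain ⟨g', hg'⟩ := ih
    refine ⟨g' ≫ a m, ?_⟩
    rw [hg', Category.assoc, ← Category.assoc (a m), ← seqι_seqShift, Category.assoc, hq]

variable {a} in
-- The finitely many components of `g` are pushed to a common stage of the sequence and added there.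
lemma exists_factor_seqι {H : T} {q : seqSigma A ⟶ H} (hq : seqShift a ≫ q = q) {C : T}
    (hC : IsFinitary C) (g : C ⟶ seqSigma A) :
    ∃ (k : ℕ) (g' : C ⟶ A k), g ≫ q = g' ≫ seqι A k ≫ q := by
  classical
  obtain ⟨s, hs⟩ := hC _ _ g
  rw [eq_sum_of_comp_sigmaTrunc_eq_zero hs]
  obtain ⟨c, hc⟩ : ∃ c : ∀ j : ULift.{v} ℕ, C ⟶ A j.down,
    ∀ j, g ≫ sigmaProj (fun j : ULift.{v} ℕ => A j.down) j = c j := ⟨_, fun _ => rfl⟩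
  simp only [hc]
  clear hs hc
  induction s using Finset.induction_on with
  | empty => exact ⟨0, 0, by simp⟩
  | insert j s hj ih =>
    obtain ⟨k, g', hg'⟩ := ih
    obtain ⟨g₁, h₁⟩ := exists_lift_seqι hq (le_max_left j.down k) (c j)
    obtain ⟨g₂, h₂⟩ := exists_lift_seqι hq (le_max_right j.down k) g'
    refine ⟨max j.down k, g₁ + g₂, ?_⟩
    rw [Finset.sum_insert hj, Preadditive.add_comp, Preadditive.add_comp, ← h₁, ← h₂, hg',
      Category.assoc]

end Telescope

section Localisation

/-! ### Localisation with respect to a set of finitary objects -/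

variable {T : Type u} [Category.{v} T] [HasZeroObject T] [HasShift T ℤ] [Preadditive T]
  [∀ n : ℤ, (shiftFunctor T n).Additive] [Pretriangulated T] [HasCoproducts.{v} T]

/-- A homotopy colimit of a sequence. -/
lemma exists_hocolim (A : ℕ → T) (a : ∀ k, A k ⟶ A (k + 1)) :
    ∃ (H : T) (q : seqSigma A ⟶ H), seqShift a ≫ q = q ∧
      (∀ S : ObjectProperty T, IsLocalising S → (∀ k, S (A k)) → S H) ∧
      (∀ (X : T) (p : ∀ k, A k ⟶ X), (∀ k, a k ≫ p (k + 1) = p k) →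
        ∃ π : H ⟶ X, ∀ k, seqι A k ≫ q ≫ π = p k) ∧
      ∀ C : T, IsFinitary C → ∀ f : C ⟶ H, ∃ (k : ℕ) (g : C ⟶ A k), f = g ≫ seqι A k ≫ q := by
  obtain ⟨H, q, d, hH⟩ := distinguished_cocone_triangle (𝟙 (seqSigma A) - seqShift a)
  have hq : seqShift a ≫ q = q := by
    have := distTriang_comp₁₂ hH
    rw [Preadditive.sub_comp, Category.id_comp, sub_eq_zero] at this
    exact this.symm
  refine ⟨H, q, hq, fun S hS h => ?_, fun X p hp => ?_, fun C hC f => ?_⟩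
  · have hD : S (seqSigma A) := hS.sigma _ fun j => h j.down
    exact hS.ext₃ hH hD hD
  · obtain ⟨π, hπ⟩ := distTriang_desc₂ hH (Sigma.desc fun j => p j.down) (by
      refine seqSigma_hom_ext fun k => ?_
      simp only [Preadditive.sub_comp, Preadditive.comp_sub, Category.id_comp, comp_zero]
      rw [← Category.assoc, seqι_seqShift]
      simp [seqι, hp])
    refine ⟨π, fun k => ?_⟩
    rw [← hπ]
    simp [seqι]
  -- The desuspension of `f ≫ d` is fixed by the shift map, because `d` followed by the suspension
  -- of `1 - shift` is zero.
  · suffices hf : f ≫ d = 0 by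
      obtain ⟨g, hg⟩ := distTriang_lift₃ hH f hf
      obtain ⟨k, g', hg'⟩ := exists_factor_seqι hq hC g
      exact ⟨k, g', hg.trans hg'⟩
    have h₀ := distTriang_comp₃₁ hH
    let e := shiftFunctorCompIsoId T (1 : ℤ) (-1) (by simp)
    have hg : (f ≫ d)⟦(-1 : ℤ)⟧' ≫ e.hom.app _ = 0 := by
      refine eq_zero_of_comp_seqShift a (hC.shift (-1)) ?_
      have h₁ : ((f ≫ d) ≫ (𝟙 (seqSigma A) - seqShift a)⟦(1 : ℤ)⟧')⟦(-1 : ℤ)⟧' ≫ e.hom.app _ = 0 := by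
        rw [Category.assoc, h₀, comp_zero, Functor.map_zero, zero_comp]
      have nat := e.hom.naturality (𝟙 (seqSigma A) - seqShift a)
      dsimp at nat
      rw [Functor.map_comp, Category.assoc, nat, Preadditive.comp_sub, Category.comp_id,
        Preadditive.comp_sub, sub_eq_zero] at h₁
      rw [Category.assoc]
      exact h₁.symm
    apply (shiftFunctor T (-1 : ℤ)).map_injective
    rw [← cancel_mono (e.hom.app (seqSigma A)), hg, Functor.map_zero, zero_comp]

variable {ι : Type v} (G : ι → T)

/-- The localising subcategory generated by a family of objects. -/
def locOf : ObjectProperty T := loc (fun Y => ∃ i, Y = G i)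

lemma isLocalising_locOf : IsLocalising (locOf G) := isLocalising_loc _

lemma mem_locOf (i : ι) : locOf G (G i) := subset_loc _ _ ⟨i, rfl⟩

lemma locOf_le {S : ObjectProperty T} (hS : IsLocalising S) (h : ∀ i, S (G i)) : locOf G ≤ S :=
  loc_le hS (by rintro _ ⟨i, rfl⟩; exact h i)

lemma exists_cover (X : T) : ∃ (A : T) (p : A ⟶ X), locOf G A ∧
    ∀ (i : ι) (n : ℤ) (f : (G i)⟦n⟧ ⟶ X), ∃ g, f = g ≫ p := by
  let Y : (Σ (i : ι) (n : ℤ), ((G i)⟦n⟧ ⟶ X)) → T := fun j => (G j.1)⟦j.2.1⟧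
  refine ⟨∐ Y, Sigma.desc fun j => j.2.2, (isLocalising_locOf G).sigma _ fun j =>
    (isLocalising_locOf G).shift (mem_locOf G j.1) _, fun i n f => ⟨Sigma.ι Y ⟨i, n, f⟩, ?_⟩⟩
  rw [Sigma.ι_desc]

lemma exists_kill {A X : T} (p : A ⟶ X) (hA : locOf G A) :
    ∃ (A' : T) (a : A ⟶ A') (p' : A' ⟶ X), locOf G A' ∧ a ≫ p' = p ∧
      ∀ (i : ι) (n : ℤ) (f : (G i)⟦n⟧ ⟶ A), f ≫ p = 0 → f ≫ a = 0 := by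
  let Y : (Σ (i : ι) (n : ℤ), {f : (G i)⟦n⟧ ⟶ A // f ≫ p = 0}) → T := fun j => (G j.1)⟦j.2.1⟧
  let b : ∐ Y ⟶ A := Sigma.desc fun j => j.2.2.1
  have hb (j) : Sigma.ι Y j ≫ b = j.2.2.1 := Sigma.ι_desc _ _
  obtain ⟨A', a, d, h⟩ := distinguished_cocone_triangle b
  obtain ⟨p', hp'⟩ := distTriang_desc₂ h p (Sigma.hom_ext _ _ fun j => by
    rw [comp_zero, ← Category.assoc, hb, j.2.2.2])
  have hab := distTriang_comp₁₂ h
  refine ⟨A', a, p', (isLocalising_locOf G).ext₃ h ((isLocalising_locOf G).sigma _ fun j =>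
    (isLocalising_locOf G).shift (mem_locOf G j.1) _) hA, hp'.symm, fun i n f hf => ?_⟩
  rw [← show Sigma.ι Y ⟨i, n, f, hf⟩ ≫ b = f from hb ⟨i, n, f, hf⟩, Category.assoc, hab, comp_zero]

/-- Start with a cover, then repeatedly cone off every morphism from a generator that dies in `X`.
In the homotopy colimit surjectivity comes from stage zero; injectivity holds because a morphism in
the kernel lives at a finite stage and dies at the next one. -/
lemma exists_approximation (hG : ∀ i, IsFinitary (G i)) (X : T) :
    ∃ (A : T) (p : A ⟶ X), locOf G A ∧ ∀ (i : ι) (n : ℤ),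
      (∀ f : (G i)⟦n⟧ ⟶ X, ∃ g, f = g ≫ p) ∧ ∀ f : (G i)⟦n⟧ ⟶ A, f ≫ p = 0 → f = 0 := by
  obtain ⟨A₀, p₀, hA₀, hp₀⟩ := exists_cover G X
  choose A' a' p' hA' hap' hf' using fun A : (Σ' (A : T) (_ : A ⟶ X), locOf G A) =>
    exists_kill G A.2.1 A.2.2
  let s : ℕ → Σ' (A : T) (_ : A ⟶ X), locOf G A :=
    fun k => k.rec ⟨A₀, p₀, hA₀⟩ fun _ B => ⟨A' B, p' B, hA' B⟩
  obtain ⟨H, q, hq, hS, hX, hC⟩ := exists_hocolim (fun k => (s k).1) (fun k => a' (s k))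
  obtain ⟨π, hπ⟩ := hX X (fun k => (s k).2.1) fun k => hap' (s k)
  refine ⟨H, π, hS _ (isLocalising_locOf G) fun k => (s k).2.2, fun i n => ⟨fun f => ?_,
    fun f hf => ?_⟩⟩
  · obtain ⟨g, hg⟩ := hp₀ i n f
    refine ⟨g ≫ seqι (fun k => (s k).1) 0 ≫ q, ?_⟩
    rw [Category.assoc, Category.assoc, hπ 0]
    exact hg
  · obtain ⟨k, g, rfl⟩ := hC _ ((hG i).shift n) f
    rw [Category.assoc, Category.assoc, hπ k] at hf
    rw [← hq, ← Category.assoc (seqι _ k), seqι_seqShift, Category.assoc, ← Category.assoc,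
      hf' (s k) i n g hf, zero_comp]

/-- Every object is an extension of an object orthogonal to the given finitary objects by an
object of the localising subcategory they generate. -/
theorem exists_triangle_locOf (hG : ∀ i, IsFinitary (G i)) (X : T) :
    ∃ (A B : T) (f : A ⟶ X) (g : X ⟶ B) (h : B ⟶ A⟦(1 : ℤ)⟧), Triangle.mk f g h ∈ distTriang T ∧
      locOf G A ∧ ∀ Z, locOf G Z → Orth Z B := by
  obtain ⟨A, p, hA, hp⟩ := exists_approximation G hG X
  obtain ⟨B, g, h, hT⟩ := distinguished_cocone_triangle p
  refine ⟨A, B, p, g, h, hT, hA, locOf_le G (isLocalising_orth_left B) fun i =>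
    orth_of_forall_shift_left fun n f => ?_⟩
  have hph := distTriang_comp₃₁ hT
  have hpg := distTriang_comp₁₂ hT
  -- Injectivity of the approximation, applied one degree lower, kills `f ≫ h`. Then `f` comes from
  -- `X`, by surjectivity from `A`, and so is zero in `B`.
  suffices hf : f ≫ h = 0 by
    obtain ⟨g₁, hg₁⟩ := distTriang_lift₃ hT f hf
    obtain ⟨g₂, rfl⟩ := (hp i n).1 g₁
    rw [hg₁, Category.assoc, hpg, comp_zero]
  let e := (shiftFunctorCompIsoId T (1 : ℤ) (-1) (by simp))
  let e' := (shiftFunctorAdd' T n (-1) (n - 1) (by omega)).app (G i)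
  have nat := e.hom.naturality p
  dsimp at nat
  have h₁ : e'.hom ≫ (f ≫ h)⟦(-1 : ℤ)⟧' ≫ e.hom.app A = 0 := by
    refine (hp i (n - 1)).2 _ ?_
    rw [Category.assoc, Category.assoc, ← nat, ← Functor.map_comp_assoc, Category.assoc, hph,
      comp_zero, Functor.map_zero, zero_comp, comp_zero]
  apply (shiftFunctor T (-1 : ℤ)).map_injective
  rw [← cancel_epi e'.hom, ← cancel_mono (e.hom.app A), Category.assoc, h₁, Functor.map_zero,
    comp_zero, zero_comp]

end Localisation

/-! ### Conjugation of graded endomorphisms, and units of the centre -/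

lemma shiftedHom_conj_comp {T : Type u} [Category.{v} T] [HasShift T ℤ]
    {A B : T} (e : A ≅ B) {m n k : ℤ} (x : ShiftedHom A A m)
    (y : ShiftedHom A A n) (h : n + m = k) :
    e.inv ≫ x.comp y h ≫ e.hom⟦k⟧' =
      ShiftedHom.comp (e.inv ≫ x ≫ e.hom⟦m⟧' : ShiftedHom B B m)
        (e.inv ≫ y ≫ e.hom⟦n⟧' : ShiftedHom B B n) h := by
  have nat := (shiftFunctorAdd' T n m k h).inv.naturality e.hom
  dsimp at nat
  simp only [ShiftedHom.comp, Category.assoc, Functor.map_comp]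
  rw [← nat, ← Functor.map_comp_assoc _ e.hom, Iso.hom_inv_id, CategoryTheory.Functor.map_id,
    Category.id_comp]

/-- The signs `(-1) ^ (m * n)` enter below as units of the centre; only their invertibility and
naturality matter. -/
lemma isIso_center_app {T : Type u} [Category.{v} T] (ε : (CatCenter T)ˣ) (X : T) :
    IsIso (ε.val.app X) :=
  ⟨ε.inv.app _, by
    rw [← NatTrans.comp_app]
    exact congr_app ε.inv_mul _, by
    rw [← NatTrans.comp_app]
    exact congr_app ε.mul_inv _⟩

section Tensor

/-! ### The action of the graded endomorphisms of the unit -/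

variable {T : Type u} [Category.{v} T] [HasZeroObject T] [HasShift T ℤ] [Preadditive T]
  [∀ n : ℤ, (shiftFunctor T n).Additive] [Pretriangulated T]
  [MonoidalCategory T] [SymmetricCategory T] [(curriedTensor T).CommShift₂Int]

lemma shiftTensorIso_naturality_right (X : T) {Y Y' : T} (f : Y ⟶ Y') (n : ℤ) :
    X⟦n⟧ ◁ f ≫ (shiftTensorIso X Y' n).hom = (shiftTensorIso X Y n).hom ≫ (X ◁ f)⟦n⟧' :=
  (NatTrans.shift_app_comm ((curriedTensor T).flip.map f) n X).symm

lemma tensorShiftIso_naturality_left {X X' : T} (f : X ⟶ X') (Y : T) (n : ℤ) :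
    f ▷ Y⟦n⟧ ≫ (tensorShiftIso X' Y n).hom = (tensorShiftIso X Y n).hom ≫ (f ▷ Y)⟦n⟧' :=
  (NatTrans.shift_app_comm ((curriedTensor T).map f) n Y).symm

/-- The effect on `X` of a graded endomorphism of the unit. -/
noncomputable def unitEnd {n : ℤ} (a : ShiftedHom (𝟙_ T) (𝟙_ T) n) (X : T) : X ⟶ X⟦n⟧ :=
  (λ_ X).inv ≫ a ▷ X ≫ (shiftTensorIso (𝟙_ T) X n).hom ≫ (λ_ X).hom⟦n⟧'

lemma unitEnd_naturality {n : ℤ} (a : ShiftedHom (𝟙_ T) (𝟙_ T) n) {X Y : T} (f : X ⟶ Y) :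
    unitEnd a X ≫ f⟦n⟧' = f ≫ unitEnd a Y := by
  simp only [unitEnd, Category.assoc, ← Functor.map_comp, ← leftUnitor_naturality]
  rw [Functor.map_comp, ← Category.assoc (shiftTensorIso (𝟙_ T) X n).hom,
    ← shiftTensorIso_naturality_right, Category.assoc, ← whisker_exchange_assoc,
    leftUnitor_inv_naturality_assoc]

lemma unitEnd_comp {m n : ℤ} (a : ShiftedHom (𝟙_ T) (𝟙_ T) m) (b : ShiftedHom (𝟙_ T) (𝟙_ T) n)
    {k : ℤ} (h : n + m = k) (X : T) :
    unitEnd (a.comp b h) X = ShiftedHom.comp (unitEnd a X) (unitEnd b X) h := by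
  -- Up to conjugation by the unitor the action is the functor `- ⊗ X` on graded morphisms, hence
  -- multiplicative.
  have hmap {l : ℤ} (c : ShiftedHom (𝟙_ T) (𝟙_ T) l) :
      unitEnd c X = (λ_ X).inv ≫ c.map (tensorRight X) ≫ (λ_ X).hom⟦l⟧' := by
    simp only [unitEnd, ShiftedHom.map, Category.assoc]
    rfl
  rw [hmap, hmap, hmap, ShiftedHom.map_comp a b h]
  exact shiftedHom_conj_comp (λ_ X) (a.map (tensorRight X)) (b.map (tensorRight X)) h

/-- The two ways of letting `a` act on `X⟦m⟧` agree up to a unit, so they have the same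
annihilators. The unit comes from the sign rule for the two shift isomorphisms, together with the
compatibility of the unitor with shifts. -/
lemma exists_unitEnd_shift [IsTensorTriangulated T] {n : ℤ}
    (a : ShiftedHom (𝟙_ T) (𝟙_ T) n) (X : T) (m : ℤ) :
    ∃ ε : (CatCenter T)ˣ,
      unitEnd a (X⟦m⟧) = (unitEnd a X)⟦m⟧' ≫ (shiftComm X n m).hom ≫ ε.val.app _ := by
  have h := Functor.commShift₂_comm (curriedTensor T) .int (𝟙_ T) X n m
  have h' : (tensorShiftIso ((𝟙_ T)⟦n⟧) X m).hom ≫ (shiftTensorIso (𝟙_ T) X n).hom⟦m⟧' =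
    (shiftTensorIso (𝟙_ T) (X⟦m⟧) n).hom ≫ (tensorShiftIso (𝟙_ T) X m).hom⟦n⟧' ≫
    (shiftComm (𝟙_ T ⊗ X) n m).inv ≫ ((CommShift₂Setup.int.ε n m).val.app _) := h
  set ε := (CommShift₂Setup.int (D := T)).ε n m
  have hε := isIso_center_app ε ((𝟙_ T ⊗ X)⟦n⟧⟦m⟧)
  let w := asIso ((shiftComm (𝟙_ T ⊗ X) n m).inv ≫ ε.val.app ((𝟙_ T ⊗ X)⟦n⟧⟦m⟧))
  have hw : (shiftTensorIso (𝟙_ T) (X⟦m⟧) n).hom ≫ (tensorShiftIso (𝟙_ T) X m).hom⟦n⟧' =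
      (tensorShiftIso ((𝟙_ T)⟦n⟧) X m).hom ≫ (shiftTensorIso (𝟙_ T) X n).hom⟦m⟧' ≫ w.inv := by
    rw [← Category.assoc, Iso.eq_comp_inv, h', Category.assoc]
    rfl
  have hl := IsTensorTriangulated.leftUnitor_shift X m
  have hl' : (λ_ (X⟦m⟧)).inv = (λ_ X).inv⟦m⟧' ≫ (tensorShiftIso (𝟙_ T) X m).inv := by
    rw [Iso.inv_eq_inv (λ_ (X⟦m⟧))
      (tensorShiftIso (𝟙_ T) X m ≪≫ (shiftFunctor T m).mapIso (λ_ X)) |>.2 hl.symm]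
    rfl
  have ha := tensorShiftIso_naturality_left a X m
  rw [← Iso.inv_comp_eq, ← Category.assoc, ← Iso.eq_comp_inv] at ha
  have hw' : w.inv ≫ (λ_ X).hom⟦m⟧'⟦n⟧' =
      (λ_ X).hom⟦n⟧'⟦m⟧' ≫ (shiftComm X n m).hom ≫ ε.inv.app _ := by
    have hC := shiftComm_hom_comp (f := (λ_ X).hom) n m
    have hn := CatCenter.naturality ε.val ((λ_ X).hom⟦n⟧'⟦m⟧' ≫ (shiftComm X n m).hom)
    have hε' : ε.val.app (X⟦m⟧⟦n⟧) ≫ ε.inv.app (X⟦m⟧⟦n⟧) = 𝟙 _ := by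
      rw [← NatTrans.comp_app]
      exact congr_app ε.inv_mul _
    rw [Category.assoc] at hn
    rw [Iso.inv_comp_eq, asIso_hom, Category.assoc, ← reassoc_of% hn, hε', Category.comp_id, ← hC,
      Iso.inv_hom_id_assoc]
  refine ⟨ε⁻¹, ?_⟩
  simp only [unitEnd, ← hl, Functor.map_comp, hl', Category.assoc]
  rw [reassoc_of% hw, reassoc_of% ha, hw']
  simp

lemma comp_unitEnd_shift_eq_zero_iff [IsTensorTriangulated T] {n m : ℤ}
    (a : ShiftedHom (𝟙_ T) (𝟙_ T) n) {C X : T} (f : C ⟶ X⟦m⟧) :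
    f ≫ unitEnd a (X⟦m⟧) = 0 ↔ f ≫ (unitEnd a X)⟦m⟧' = 0 := by
  obtain ⟨ε, h⟩ := exists_unitEnd_shift a X m
  have := isIso_center_app ε (X⟦m⟧⟦n⟧)
  rw [h, ← Category.assoc]
  exact Preadditive.IsIso.comp_right_eq_zero _ _

/-! ### Koszul objects -/

/-- The cone of a graded endomorphism of the unit. -/
noncomputable def unitCone {n : ℤ} (a : ShiftedHom (𝟙_ T) (𝟙_ T) n) : T :=
  (distinguished_cocone_triangle a).choose

variable [IsTensorTriangulated T]

/-- Exactness of `- ⊗ X`, applied to the triangle that defines `unitCone a`. -/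
lemma exists_unitCone_distTriang {n : ℤ} (a : ShiftedHom (𝟙_ T) (𝟙_ T) n) (X : T) :
    ∃ (g : X⟦n⟧ ⟶ unitCone a ⊗ X) (h : unitCone a ⊗ X ⟶ X⟦(1 : ℤ)⟧),
      Triangle.mk (unitEnd a X) g h ∈ distTriang T := by
  obtain ⟨b, c, H⟩ := (distinguished_cocone_triangle a).choose_spec
  have := IsTensorTriangulated.tensorRight_exact X
  have H' := (tensorRight X).map_distinguished _ H
  let e₂ := shiftTensorIso (𝟙_ T) X n ≪≫ (shiftFunctor T n).mapIso (λ_ X)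
  refine ⟨e₂.inv ≫ b ▷ X, c ▷ X ≫ (shiftTensorIso (𝟙_ T) X 1).hom ≫ (λ_ X).hom⟦(1 : ℤ)⟧',
    isomorphic_distinguished _ H' _ (Triangle.isoMk _ _ (λ_ X).symm e₂.symm (Iso.refl _) ?_ ?_ ?_)⟩
  · change unitEnd a X ≫ e₂.inv = (λ_ X).inv ≫ a ▷ X
    simp [unitEnd, e₂]
  · exact Category.comp_id _
  · change (c ▷ X ≫ (shiftTensorIso (𝟙_ T) X 1).hom ≫ (λ_ X).hom⟦(1 : ℤ)⟧') ≫
      (λ_ X).inv⟦(1 : ℤ)⟧' = 𝟙 _ ≫ c ▷ X ≫ (shiftTensorIso (𝟙_ T) X 1).hom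
    simp

/-- By naturality `a` vanishes on the image of `X⟦n⟧` in the cone, so its action factors through
`X⟦1⟧`; a second application of `a` meets the composite of `h` with the action on `X⟦1⟧`, which is
zero. -/
lemma unitEnd_comp_self_unitCone {n : ℤ} (a : ShiftedHom (𝟙_ T) (𝟙_ T) n) (X : T) :
    unitEnd a (unitCone a ⊗ X) ≫ unitEnd a ((unitCone a ⊗ X)⟦n⟧) = 0 := by
  obtain ⟨g, h, H⟩ := exists_unitCone_distTriang a X
  have h₁ : g ≫ unitEnd a (unitCone a ⊗ X) = 0 := by
    obtain ⟨ε, h⟩ := exists_unitEnd_shift a X n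
    have hgg := (CatCenter.naturality ε.val (g⟦n⟧')).symm
    have hs : (shiftComm X n n).hom = 𝟙 _ := by
      simp [shiftComm]
    rw [← unitEnd_naturality, h, hs, Category.id_comp, Category.assoc, hgg, ← Functor.map_comp_assoc,
      distTriang_comp₁₂ H, Functor.map_zero, zero_comp]
  obtain ⟨l, hl⟩ := distTriang_desc₃ H _ h₁
  rw [hl, Category.assoc, ← unitEnd_naturality, ← Category.assoc,
    (comp_unitEnd_shift_eq_zero_iff a h).2 (distTriang_comp₃₁ H), zero_comp]

/-- Both vanishing conditions say that `a` acts bijectively on `Hom^*(A, Y)`: the triangle on `A`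
expresses this through composition on the left, the triangle on `Y` on the right, and naturality
identifies the two actions. No dual objects are needed. -/
lemma Orth.of_unitCone_left {n : ℤ} {a : ShiftedHom (𝟙_ T) (𝟙_ T) n} {A Y : T}
    (h : Orth (unitCone a ⊗ A) Y) : Orth A (unitCone a ⊗ Y) := by
  intro m f
  suffices key : ∀ W : T, Orth (unitCone a ⊗ A) W → ∀ f : A ⟶ unitCone a ⊗ W, f = 0 by
    rw [← cancel_mono (tensorShiftIso (unitCone a) Y m).inv, zero_comp]
    exact key _ (h.shift_right m) _
  intro W hW f
  obtain ⟨g, c, H⟩ := exists_unitCone_distTriang a A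
  obtain ⟨g', c', H'⟩ := exists_unitCone_distTriang a W
  -- Injectivity of `a` kills the component in `W⟦1⟧`; surjectivity of `a` then shows that what
  -- remains comes from a multiple of `a`, which dies in the cone.
  have hfc : f ≫ c' = 0 := by
    have h₀ : unitEnd a A ≫ (f ≫ c')⟦n⟧' = 0 := by
      rw [unitEnd_naturality, Category.assoc,
        (comp_unitEnd_shift_eq_zero_iff a c').2 (distTriang_comp₃₁ H'), comp_zero]
    obtain ⟨l, hl⟩ := distTriang_desc₂ H _ h₀
    apply (shiftFunctor T n).map_injective
    rw [hl, ((hW.shift_right 1).shift_right n).eq_zero l, comp_zero, Functor.map_zero]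
  obtain ⟨y, rfl⟩ := distTriang_lift₃ H' f hfc
  obtain ⟨x, rfl⟩ := distTriang_desc₁ H y (((hW.shift_right n).shift_right 1).eq_zero _)
  obtain ⟨z, rfl⟩ := (shiftFunctor T n).map_surjective x
  rw [unitEnd_naturality, Category.assoc, distTriang_comp₁₂ H', comp_zero]

lemma Orth.unitCone_left {n : ℤ} {a : ShiftedHom (𝟙_ T) (𝟙_ T) n} {A Y : T}
    (h : Orth A (unitCone a ⊗ Y)) : Orth (unitCone a ⊗ A) Y := by
  intro m f
  have hs (W : T) (k : ℤ) (hW : Orth A (unitCone a ⊗ W)) : Orth A (unitCone a ⊗ W⟦k⟧) :=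
    (hW.shift_right k).of_iso_right (tensorShiftIso (unitCone a) W k).symm
  suffices key : ∀ Z : T, Orth A (unitCone a ⊗ Z) → ∀ f : unitCone a ⊗ A ⟶ Z, f = 0 from
    key _ (hs Y m h) f
  intro Z hZ f
  obtain ⟨g, c, H⟩ := exists_unitCone_distTriang a A
  have inj (x : A⟦n⟧ ⟶ Z) (hx : unitEnd a A ≫ x = 0) : x = 0 := by
    let e : Z⟦-n⟧⟦n⟧ ≅ Z := (shiftFunctorCompIsoId T (-n) n (by simp)).app Z
    obtain ⟨z, hz⟩ := (shiftFunctor T n).map_surjective (x ≫ e.inv)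
    obtain ⟨g', c', H'⟩ := exists_unitCone_distTriang a (Z⟦-n⟧)
    have h₀ : z ≫ unitEnd a (Z⟦-n⟧) = 0 := by
      rw [← unitEnd_naturality, hz, reassoc_of% hx, zero_comp]
    obtain ⟨l, hl⟩ := distTriang_lift₁ H' (z⟦(1 : ℤ)⟧') (by
      rw [← Functor.map_comp, h₀, Functor.map_zero])
    have hz₀ : z = 0 := by
      apply (shiftFunctor T (1 : ℤ)).map_injective
      rw [hl, ((hs _ _ hZ).shift_left 1).eq_zero l, zero_comp, Functor.map_zero]
    rw [← cancel_mono e.inv, ← hz, hz₀, Functor.map_zero, zero_comp]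
  have surj (Z : T) (hZ : Orth A (unitCone a ⊗ Z)) (y : A ⟶ Z) :
      ∃ x : A⟦n⟧ ⟶ Z, y = unitEnd a A ≫ x := by
    let e : Z⟦-n⟧⟦n⟧ ≅ Z := (shiftFunctorCompIsoId T (-n) n (by simp)).app Z
    obtain ⟨g', c', H'⟩ := exists_unitCone_distTriang a (Z⟦-n⟧)
    obtain ⟨z, hz⟩ := distTriang_lift₂ H' (y ≫ e.inv) ((hs _ _ hZ).eq_zero _)
    refine ⟨z⟦n⟧' ≫ e.hom, ?_⟩
    rw [← Category.assoc, unitEnd_naturality, ← hz, Category.assoc, e.inv_hom_id,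
      Category.comp_id]
  obtain ⟨k, rfl⟩ := distTriang_desc₃ H f (inj _ (by
    rw [← Category.assoc, distTriang_comp₁₂ H, zero_comp]))
  let e : Z⟦(-1 : ℤ)⟧⟦(1 : ℤ)⟧ ≅ Z := (shiftFunctorCompIsoId T (-1 : ℤ) 1 (by simp)).app Z
  obtain ⟨k', hk'⟩ := (shiftFunctor T (1 : ℤ)).map_surjective (k ≫ e.inv)
  obtain ⟨x, rfl⟩ := surj _ (hs _ (-1) hZ) k'
  rw [← cancel_mono e.inv, Category.assoc, ← hk', Functor.map_comp, ← Category.assoc,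
    distTriang_comp₃₁ H, zero_comp, zero_comp]

/-- The Koszul object of a list of graded endomorphisms of the unit. -/
noncomputable def koszul : List (Σ n : ℤ, ShiftedHom (𝟙_ T) (𝟙_ T) n) → T
  | [] => 𝟙_ T
  | a :: l => unitCone a.2 ⊗ koszul l

variable (l : List (Σ n : ℤ, ShiftedHom (𝟙_ T) (𝟙_ T) n))

/-- Any property of objects that passes from `X` to the cone of `unitEnd a X` passes from `X` to
its tensor products with Koszul objects. -/
lemma koszul_tensor_induction {P : T → Prop} (hP : ∀ ⦃X Y : T⦄, (X ≅ Y) → P X → P Y)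
    (hc : ∀ a ∈ l, ∀ X : T, P X → P (unitCone a.2 ⊗ X)) {X : T} (hX : P X) : P (koszul l ⊗ X) := by
  induction l with
  | nil => exact hP (λ_ X).symm hX
  | cons a l ih =>
    exact hP (α_ _ _ _).symm (hc a (by simp) _ (ih fun b hb => hc b (by simp [hb])))

/-- The cones cross over one at a time and arrive in reverse order; the braiding restores the order.
-/
lemma Orth.of_koszul_left {A Y : T} (h : Orth (koszul l ⊗ A) Y) : Orth A (koszul l ⊗ Y) := by
  induction l generalizing A Y with
  | nil => exact (h.of_iso_left (λ_ A)).of_iso_right (λ_ Y).symm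
  | cons a l ih =>
    refine (ih (h.of_iso_left (α_ _ _ _)).of_unitCone_left).of_iso_right ?_
    exact (α_ _ _ _).symm ≪≫ whiskerRightIso (β_ _ _) Y

lemma Orth.koszul_left {A Y : T} (h : Orth A (koszul l ⊗ Y)) : Orth (koszul l ⊗ A) Y := by
  induction l generalizing A Y with
  | nil => exact (h.of_iso_left (λ_ A).symm).of_iso_right (λ_ Y)
  | cons a l ih =>
    refine (Orth.unitCone_left (ih (h.of_iso_right ?_))).of_iso_left (α_ _ _ _).symm
    exact whiskerRightIso (β_ _ _) Y ≪≫ α_ _ _ _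

lemma IsFinitary.koszul [HasCoproducts.{v} T] (h : IsFinitary (𝟙_ T)) :
    IsFinitary (koszul l) := by
  refine (koszul_tensor_induction (P := IsFinitary) l (fun X Y e => .of_iso e) (fun a _ X hX => ?_)
    h).of_iso (ρ_ _)
  obtain ⟨g, c, H⟩ := exists_unitCone_distTriang a.2 X
  exact IsFinitary.ext₃ H hX (hX.shift _)

lemma IsLocalising.koszul_tensor {S : ObjectProperty T} (hS : IsLocalising S) {X : T}
    (hX : S X) : S (BIK.koszul l ⊗ X) := by
  refine koszul_tensor_induction l (fun X Y e => hS.of_iso e) (fun a _ X hX => ?_) hX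
  obtain ⟨g, c, H⟩ := exists_unitCone_distTriang a.2 X
  exact hS.ext₃ H hX (hS.shift hX _)

end Tensor

section GradedIdeals

/-! ### Homogeneous ideals of graded commutative rings -/

open GradedRing DirectSum SetLike Finset

variable {R : Type w} [Ring R] {𝒜 : ℤ → AddSubgroup R} [GradedRing 𝒜]

/-- The primality of a two-sided homogeneous ideal can be tested on homogeneous elements. -/
theorem isPrime_of_homogeneous {I : Ideal R} [I.IsTwoSided] (hI : I.IsHomogeneous 𝒜)
    (I_ne_top : I ≠ ⊤)
    (homogeneous_mem_or_mem : ∀ {x y : R}, IsHomogeneousElem 𝒜 x → IsHomogeneousElem 𝒜 y →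
      x * y ∈ I → x ∈ I ∨ y ∈ I) : I.IsPrime := by
  classical
  refine ⟨I_ne_top, fun {x y} hxy => ?_⟩
  by_contra! ⟨rid₁, rid₂⟩
  set set₁ := {i ∈ (decompose 𝒜 x).support | proj 𝒜 i x ∉ I} with set₁_eq
  set set₂ := {i ∈ (decompose 𝒜 y).support | proj 𝒜 i y ∉ I} with set₂_eq
  have nonempty :
    ∀ x : R, x ∉ I → {i ∈ (decompose 𝒜 x).support | proj 𝒜 i x ∉ I}.Nonempty := by
    intro x hx
    rw [filter_nonempty_iff]
    contrapose! hx
    simp_rw [proj_apply] at hx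
    rw [← sum_support_decompose 𝒜 x]
    exact Ideal.sum_mem _ hx
  set max₁ := set₁.max' (nonempty x rid₁)
  set max₂ := set₂.max' (nonempty y rid₂)
  have mem_max₁ : max₁ ∈ set₁ := max'_mem set₁ (nonempty x rid₁)
  have mem_max₂ : max₂ ∈ set₂ := max'_mem set₂ (nonempty y rid₂)
  replace hxy : proj 𝒜 (max₁ + max₂) (x * y) ∈ I := hI _ hxy
  have mem_I : proj 𝒜 max₁ x * proj 𝒜 max₂ y ∈ I := by
    set antidiag :=
      {z ∈ (decompose 𝒜 x).support ×ˢ (decompose 𝒜 y).support | z.1 + z.2 = max₁ + max₂}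
       with ha
    have mem_antidiag : (max₁, max₂) ∈ antidiag := by
      simp only [antidiag, mem_filter, mem_product]
      exact ⟨⟨mem_of_mem_filter _ mem_max₁, mem_of_mem_filter _ mem_max₂⟩, trivial⟩
    have eq_add_sum :=
      calc
        proj 𝒜 (max₁ + max₂) (x * y) = ∑ ij ∈ antidiag, proj 𝒜 ij.1 x * proj 𝒜 ij.2 y := by
          simp_rw [ha, proj_apply, DirectSum.decompose_mul, DirectSum.coe_mul_apply 𝒜]
        _ =
            proj 𝒜 max₁ x * proj 𝒜 max₂ y +
              ∑ ij ∈ antidiag.erase (max₁, max₂), proj 𝒜 ij.1 x * proj 𝒜 ij.2 y :=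
          (add_sum_erase _ _ mem_antidiag).symm
    rw [eq_sub_of_add_eq eq_add_sum.symm]
    refine Ideal.sub_mem _ hxy (Ideal.sum_mem _ fun z H => ?_)
    rcases z with ⟨i, j⟩
    simp only [antidiag, mem_erase, Prod.mk_inj, Ne, mem_filter, mem_product] at H
    rcases H with ⟨H₁, ⟨H₂, H₃⟩, H₄⟩
    have max_lt : max₁ < i ∨ max₂ < j := by
      convert! le_or_lt_of_add_le_add H₄.ge using 1
      rw [Ne.le_iff_lt]
      rintro rfl
      cases H₁ ⟨rfl, add_left_cancel H₄⟩
    rcases max_lt with max_lt | max_lt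
    · have notMem : i ∉ set₁ := fun h =>
        lt_irrefl _ ((max'_lt_iff set₁ (nonempty x rid₁)).mp max_lt i h)
      rw [set₁_eq] at notMem
      simp only [not_and, Classical.not_not, mem_filter] at notMem
      exact Ideal.mul_mem_right _ I (notMem H₂)
    · have notMem : j ∉ set₂ := fun h =>
        lt_irrefl _ ((max'_lt_iff set₂ (nonempty y rid₂)).mp max_lt j h)
      rw [set₂_eq] at notMem
      simp only [not_and, Classical.not_not, mem_filter] at notMem
      exact Ideal.mul_mem_left I _ (notMem H₃)
  have notMem_I : proj 𝒜 max₁ x * proj 𝒜 max₂ y ∉ I := by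
    have neither_mem : proj 𝒜 max₁ x ∉ I ∧ proj 𝒜 max₂ y ∉ I := by
      rw [mem_filter] at mem_max₁ mem_max₂
      exact ⟨mem_max₁.2, mem_max₂.2⟩
    intro _rid
    rcases homogeneous_mem_or_mem ⟨max₁, SetLike.coe_mem _⟩ ⟨max₂, SetLike.coe_mem _⟩ mem_I
      with h | h
    · apply neither_mem.1 h
    · apply neither_mem.2 h
  exact notMem_I mem_I

lemma mul_mem_comm (hcomm : IsGradedCommutative 𝒜) {I : Ideal R} {x y : R}
    (hx : IsHomogeneousElem 𝒜 x) (hy : IsHomogeneousElem 𝒜 y) (h : x * y ∈ I) : y * x ∈ I := by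
  obtain ⟨m, hx⟩ := hx
  obtain ⟨n, hy⟩ := hy
  rw [hcomm n m y x hy hx]
  exact zsmul_mem h _

/-- `Ideal R` consists of left ideals. Homogeneous components commute up to sign, and a sign does
not affect membership. -/
lemma isTwoSided_of_isHomogeneous (hcomm : IsGradedCommutative 𝒜) {I : Ideal R}
    (hI : I.IsHomogeneous 𝒜) : I.IsTwoSided := by
  classical
  refine ⟨fun {a} b ha => ?_⟩
  rw [← sum_support_decompose 𝒜 a, ← sum_support_decompose 𝒜 b, Finset.sum_mul_sum]
  exact Ideal.sum_mem _ fun i _ => Ideal.sum_mem _ fun j _ =>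
    mul_mem_comm hcomm ⟨j, SetLike.coe_mem _⟩ ⟨i, SetLike.coe_mem _⟩ (I.mul_mem_left _ (hI i ha))

lemma mul_mul_mem (hcomm : IsGradedCommutative 𝒜) {I : Ideal R} {x y : R}
    (hx : IsHomogeneousElem 𝒜 x) (h : x * y ∈ I) (t : R) : x * (t * y) ∈ I := by
  classical
  obtain ⟨m, hx⟩ := hx
  rw [← sum_support_decompose 𝒜 t, Finset.sum_mul, Finset.mul_sum]
  refine Ideal.sum_mem _ fun i _ => ?_
  rw [← mul_assoc, hcomm m i x _ hx (SetLike.coe_mem _), smul_mul_assoc, mul_assoc]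
  exact zsmul_mem (I.mul_mem_left _ h) _

/-- A homogeneous ideal disjoint from a multiplicative set of homogeneous elements is contained in
a homogeneous prime disjoint from that set. -/
theorem exists_homogeneousSpec_disjoint [IsNoetherianRing R] (hcomm : IsGradedCommutative 𝒜)
    {I : Ideal R} (hI : I.IsHomogeneous 𝒜) (W : Submonoid R) (hd : ∀ w ∈ W, w ∉ I) :
    ∃ q : HomogeneousSpec 𝒜, I ≤ q.1.toIdeal ∧ ∀ w ∈ W, w ∉ q.1.toIdeal := by
  obtain ⟨P, ⟨hP, hIP, hPW⟩, hmax⟩ := set_has_maximal_iff_noetherian.mpr ‹IsNoetherianRing R›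
    {J : Ideal R | J.IsHomogeneous 𝒜 ∧ I ≤ J ∧ ∀ w ∈ W, w ∉ J} ⟨I, hI, le_rfl, hd⟩
  have := isTwoSided_of_isHomogeneous hcomm hP
  -- By maximality, enlarging `P` by a homogeneous `x` outside it produces an element of `W`.
  have key {x : R} (hx : IsHomogeneousElem 𝒜 x) (hxP : x ∉ P) :
      ∃ w ∈ W, ∃ i ∈ P, ∃ r : R, w = i + r * x := by
    by_contra! h
    refine hmax (P ⊔ Ideal.span {x}) ⟨?_, hIP.trans le_sup_left, fun w hw hwm => ?_⟩
      (lt_of_le_of_ne le_sup_left fun e => hxP ?_)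
    · exact Ideal.IsHomogeneous.sup hP
        (Ideal.homogeneous_span 𝒜 _ (by rintro _ rfl; exact hx))
    · obtain ⟨i, hi, z, hz, rfl⟩ := Submodule.mem_sup.1 hwm
      obtain ⟨r, rfl⟩ := Ideal.mem_span_singleton'.1 hz
      exact h _ hw i hi r rfl
    · rw [e]
      exact (le_sup_right : Ideal.span {x} ≤ _) (Ideal.mem_span_singleton_self x)
  refine ⟨⟨⟨P, hP⟩, isPrime_of_homogeneous hP ?_ fun {x y} hx hy hxy => ?_⟩, hIP, hPW⟩
  · rintro rfl
    exact hPW 1 W.one_mem trivial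
  · by_contra! h
    obtain ⟨w₁, hw₁, i, hi, r, h₁⟩ := key hx h.1
    obtain ⟨w₂, hw₂, j, hj, t, h₂⟩ := key hy h.2
    refine hPW _ (W.mul_mem hw₁ hw₂) ?_
    -- If `x * y` lies in `P`, every term of this expansion lies in `P`, although `W` misses `P`;
    -- for the last term `t` is moved past `x` by graded commutativity.
    have e : w₁ * w₂ = w₁ * j + (i * (t * y) + r * (x * (t * y))) := by
      conv_lhs => rw [h₂, mul_add]
      rw [add_right_inj, h₁, add_mul, mul_assoc r]
    rw [e]
    exact P.add_mem (Ideal.mul_mem_left P _ hj) (P.add_mem (Ideal.mul_mem_right _ _ hi)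
      (Ideal.mul_mem_left P _ (mul_mul_mem hcomm hx hxy t)))

/-- A homogeneous ideal of a noetherian graded ring is generated by a finite list of homogeneous
elements. -/
lemma exists_list_span_eq [IsNoetherianRing R] {I : Ideal R} (hI : I.IsHomogeneous 𝒜) :
    ∃ l : List (Σ n : ℤ, 𝒜 n), Ideal.span {x | ∃ a ∈ l, x = (a.2 : R)} = I := by
  have hspan : Ideal.span {x | x ∈ I ∧ IsHomogeneousElem 𝒜 x} = I := by
    classical
    refine le_antisymm (Ideal.span_le.2 fun x hx => hx.1) fun x hx => ?_
    rw [← sum_support_decompose 𝒜 x]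
    exact Ideal.sum_mem _ fun i _ => Ideal.subset_span ⟨hI i hx, i, SetLike.coe_mem _⟩
  obtain ⟨s, hs, hs'⟩ := (Submodule.fg_span_iff_fg_span_finset_subset _).1
    (IsNoetherian.noetherian (Ideal.span {x | x ∈ I ∧ IsHomogeneousElem 𝒜 x}))
  choose d hd using fun x : s => (hs x.2).2
  refine ⟨s.attach.toList.map fun x => ⟨d x, x, hd x⟩, ?_⟩
  rw [← hspan]
  refine Eq.trans ?_ hs'.symm
  change Ideal.span _ = Ideal.span _
  congr 1
  ext x
  constructor
  · rintro ⟨a, ha, rfl⟩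
    obtain ⟨y, -, rfl⟩ := List.mem_map.1 ha
    exact y.2
  · intro hx
    exact ⟨_, List.mem_map.2 ⟨⟨x, hx⟩, by simp, rfl⟩, rfl⟩

/-- This supplies minimal primes in supports. The empty spectrum is separate, as its dimension is
`⊥`. -/
lemma wellFounded_homogeneousSpec (hdim : HasFiniteKrullDim 𝒜) :
    WellFounded ((· < ·) : HomogeneousSpec 𝒜 → HomogeneousSpec 𝒜 → Prop) := by
  rcases isEmpty_or_nonempty (HomogeneousSpec 𝒜) with h | h
  · exact ⟨fun a => isEmptyElim a⟩
  · have : FiniteDimensionalOrder (HomogeneousSpec 𝒜) :=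
      Order.finiteDimensionalOrder_iff_krullDim_ne_bot_and_top.2
        ⟨Order.krullDim_ne_bot_iff.2 h, hdim.ne⟩
    exact SetRel.IsWellFounded.of_finiteDimensional
      {(a, b) : HomogeneousSpec 𝒜 × HomogeneousSpec 𝒜 | a < b}

end GradedIdeals

section Torsion

/-! ### Annihilators of morphisms -/

open DirectSum SetLike

variable {R : Type w} [Ring R] {𝒜 : ℤ → AddSubgroup R} [GradedRing 𝒜]
  {T : Type u} [Category.{v} T] [HasZeroObject T] [HasShift T ℤ] [Preadditive T]
  [∀ n : ℤ, (shiftFunctor T n).Additive] [Pretriangulated T]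
  [MonoidalCategory T] [SymmetricCategory T] [(curriedTensor T).CommShift₂Int]
  [IsTensorTriangulated T] (φ : UnitAction 𝒜 T)

namespace UnitAction

lemma toEnd_add (X : T) {n : ℤ} (r s : 𝒜 n) :
    φ.toEnd X (r + s) = φ.toEnd X r + φ.toEnd X s := by
  have := IsTensorTriangulated.tensorRight_exact X
  have h (a b : ShiftedHom (𝟙_ T) (𝟙_ T) n) : (a + b) ▷ X = a ▷ X + b ▷ X :=
    (tensorRight X).map_add
  simp only [toEnd, map_add]
  rw [h]
  simp

lemma toEnd_zero (X : T) (n : ℤ) : φ.toEnd X (0 : 𝒜 n) = 0 := by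
  have h := φ.toEnd_add X (0 : 𝒜 n) 0
  rwa [add_zero, left_eq_add] at h

lemma toEnd_mul (X : T) {i j n : ℤ} (h : i + j = n) (x : 𝒜 i) (y : 𝒜 j) (z : 𝒜 n)
    (hz : (z : R) = x * y) :
    φ.toEnd X z = ShiftedHom.comp (φ.toEnd X y) (φ.toEnd X x) h := by
  subst h
  obtain ⟨z, hz'⟩ := z
  obtain rfl : z = x * y := hz
  refine Eq.trans ?_ (unitEnd_comp (φ.toHom j y) (φ.toHom i x) rfl X)
  rw [← φ.map_mul]
  rfl

lemma comp_toEnd_one_eq_zero_iff {C X : T} (f : C ⟶ X) (z : 𝒜 0) (hz : (z : R) = 1) :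
    f ≫ φ.toEnd X z = 0 ↔ f = 0 := by
  obtain ⟨z, hz'⟩ := z
  obtain rfl : z = 1 := hz
  have h : φ.toEnd X (⟨1, hz'⟩ : 𝒜 0) =
      (λ_ X).inv ≫ (φ.toHom 0 ⟨1, SetLike.GradedOne.one_mem⟩).map (tensorRight X) ≫
        (λ_ X).hom⟦(0 : ℤ)⟧' := by
    simp only [toEnd, ShiftedHom.map, Category.assoc]
    rfl
  have h' : IsIso (φ.toEnd X (⟨1, hz'⟩ : 𝒜 0)) := by
    rw [h, φ.map_one, ShiftedHom.map_mk₀]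
    dsimp [ShiftedHom.mk₀]
    infer_instance
  exact Preadditive.IsIso.comp_right_eq_zero _ _

lemma toEnd_naturality {n : ℤ} (r : 𝒜 n) {X Y : T} (f : X ⟶ Y) :
    φ.toEnd X r ≫ f⟦n⟧' = f ≫ φ.toEnd Y r :=
  unitEnd_naturality (φ.toHom n r) f

lemma comp_toEnd_shift_eq_zero_iff {n m : ℤ} (r : 𝒜 n) {C X : T} (f : C ⟶ X⟦m⟧) :
    f ≫ φ.toEnd (X⟦m⟧) r = 0 ↔ f ≫ (φ.toEnd X r)⟦m⟧' = 0 :=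
  comp_unitEnd_shift_eq_zero_iff (φ.toHom n r) f

lemma comp_toEnd_mul_eq_zero_iff {C X : T} (f : C ⟶ X) {i j n : ℤ} (h : i + j = n) (x : 𝒜 i)
    (y : 𝒜 j) (z : 𝒜 n) (hz : (z : R) = x * y) :
    f ≫ φ.toEnd X z = 0 ↔ (f ≫ φ.toEnd X y) ≫ φ.toEnd (X⟦j⟧) x = 0 := by
  rw [φ.comp_toEnd_shift_eq_zero_iff, φ.toEnd_mul X h x y z hz, ShiftedHom.comp,
    ← Category.assoc, ← Category.assoc]
  exact Preadditive.IsIso.comp_right_eq_zero _ _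

/-- The annihilator of a morphism, a homogeneous left ideal. -/
noncomputable def ann {C X : T} (f : C ⟶ X) : Ideal R where
  -- Testing each component makes the ideal homogeneous by construction.
  carrier := {x | ∀ n, f ≫ φ.toEnd X (decompose 𝒜 x n) = 0}
  add_mem' {x y} hx hy n := by
    rw [decompose_add, DirectSum.add_apply, toEnd_add, Preadditive.comp_add, hx n, hy n, add_zero]
  zero_mem' n := by rw [decompose_zero, DirectSum.zero_apply, toEnd_zero, comp_zero]
  smul_mem' c x hx := by
    refine DirectSum.Decomposition.inductionOn 𝒜 (fun n => ?_) (fun {i} c n => ?_)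
      (fun a b ha hb n => ?_) c
    · rw [zero_smul, decompose_zero, DirectSum.zero_apply, toEnd_zero, comp_zero]
    · obtain ⟨j, rfl⟩ : ∃ j, n = i + j := ⟨n - i, by ring⟩
      change f ≫ φ.toEnd X (decompose 𝒜 ((c : R) * x) (i + j)) = 0
      rw [φ.comp_toEnd_mul_eq_zero_iff f rfl c (decompose 𝒜 x j) _
        (coe_decompose_mul_add_of_left_mem 𝒜 c.2), hx j, zero_comp]
    · rw [add_smul, decompose_add, DirectSum.add_apply, toEnd_add, Preadditive.comp_add, ha n,
        hb n, add_zero]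

lemma mem_ann_iff {C X : T} (f : C ⟶ X) {n : ℤ} (x : 𝒜 n) :
    (x : R) ∈ φ.ann f ↔ f ≫ φ.toEnd X x = 0 := by
  refine ⟨fun h => ?_, fun h m => ?_⟩
  · have := h n
    rwa [decompose_coe, of_eq_same] at this
  · rw [decompose_coe]
    by_cases hm : m = n
    · subst hm
      rwa [of_eq_same]
    · rw [of_eq_of_ne _ _ _ hm, toEnd_zero, comp_zero]

lemma isHomogeneous_ann {C X : T} (f : C ⟶ X) : (φ.ann f).IsHomogeneous 𝒜 :=
  fun n _ hx => (φ.mem_ann_iff f _).2 (hx n)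

lemma mul_mem_ann_iff {C X : T} (f : C ⟶ X) {i j : ℤ} (x : 𝒜 i) (y : 𝒜 j) :
    (x : R) * y ∈ φ.ann f ↔ (x : R) ∈ φ.ann (f ≫ φ.toEnd X y) := by
  rw [φ.mem_ann_iff, ← φ.comp_toEnd_mul_eq_zero_iff f rfl x y
    ⟨x * y, SetLike.GradedMul.mul_mem x.2 y.2⟩ rfl, ← φ.mem_ann_iff]

lemma one_mem_ann_iff {C X : T} (f : C ⟶ X) : (1 : R) ∈ φ.ann f ↔ f = 0 := by
  rw [← φ.comp_toEnd_one_eq_zero_iff f ⟨1, SetLike.GradedOne.one_mem⟩ rfl, ← φ.mem_ann_iff]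

lemma ann_le_comp {C X Y : T} (f : C ⟶ X) (g : X ⟶ Y) : φ.ann f ≤ φ.ann (f ≫ g) := by
  intro x hx n
  rw [Category.assoc, ← toEnd_naturality, ← Category.assoc, hx n, zero_comp]

lemma ann_le_precomp {C D X : T} (g : D ⟶ C) (f : C ⟶ X) : φ.ann f ≤ φ.ann (g ≫ f) := by
  intro x hx n
  rw [Category.assoc, hx n, comp_zero]

lemma ann_comp_iso {C X Y : T} (f : C ⟶ X) (g : X ⟶ Y) [IsIso g] :
    φ.ann (f ≫ g) = φ.ann f := by
  refine le_antisymm ?_ (φ.ann_le_comp f g)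
  simpa using φ.ann_le_comp (f ≫ g) (inv g)

lemma ann_iso_comp {C D X : T} (g : D ⟶ C) [IsIso g] (f : C ⟶ X) :
    φ.ann (g ≫ f) = φ.ann f := by
  refine le_antisymm ?_ (φ.ann_le_precomp g f)
  simpa using φ.ann_le_precomp (inv g) (g ≫ f)

lemma ann_shift {C X : T} (f : C ⟶ X) (m : ℤ) : φ.ann (f⟦m⟧') = φ.ann f := by
  ext x
  refine forall_congr' fun n => ?_
  rw [comp_toEnd_shift_eq_zero_iff, ← Functor.map_comp]
  exact (shiftFunctor T m).map_eq_zero_iff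

lemma smul_eq_zero_iff {C Y : T} {m n : ℤ} (r : 𝒜 n) (f : ShiftedHom C Y m) :
    φ.smul r f = 0 ↔ (r : R) ∈ φ.ann (show C ⟶ Y⟦m⟧ from f) := by
  rw [φ.mem_ann_iff, φ.comp_toEnd_shift_eq_zero_iff, smul, ShiftedHom.comp, ← Category.assoc]
  exact Preadditive.IsIso.comp_right_eq_zero _ _

end UnitAction

/-! ### Torsion objects -/

namespace UnitAction

/-- Every graded morphism from `C` to `Y` is annihilated by an element of `W`. -/
def Van (W : Submonoid R) (C Y : T) : Prop :=
  ∀ (m : ℤ) (f : C ⟶ Y⟦m⟧), ∃ w ∈ W, w ∈ φ.ann f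

variable {φ} {W : Submonoid R} {C : T}

/-- Allowing any target isomorphic to a shift of `Y` avoids transport between iterated shifts. -/
lemma Van.exists_mem {Y Z : T} (h : φ.Van W C Y) {m : ℤ} (e : Y⟦m⟧ ≅ Z) (f : C ⟶ Z) :
    ∃ w ∈ W, w ∈ φ.ann f := by
  obtain ⟨w, hw, hwf⟩ := h m (f ≫ e.inv)
  exact ⟨w, hw, by rwa [ann_comp_iso] at hwf⟩

variable (hcomm : IsGradedCommutative 𝒜) (hW : W ≤ homogeneousSubmonoid 𝒜)
include hcomm hW

/-- `Van` says that `Hom^*(C, -)` vanishes after inverting `W`. Localisation is exact, and a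
finitary `C` needs only a common annihilator of finitely many components. -/
lemma isLocalising_van [HasCoproducts.{v} T] (hC : IsFinitary C) :
    IsLocalising (fun Y => φ.Van W C Y) := by
  refine .mk' (fun X Y e h m f => ?_) (fun X hX m f => ⟨1, W.one_mem, ?_⟩) (fun X k h m f => ?_)
    (fun A hA h₁ h₃ m f => ?_) (fun J X h m f => ?_)
  · exact h.exists_mem ((shiftFunctor T m).mapIso e) f
  · rw [one_mem_ann_iff]
    exact ((shiftFunctor T m).map_isZero hX).eq_of_tgt _ _
  · exact h.exists_mem ((shiftFunctorAdd T k m).app X) f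
  · obtain ⟨w, hw, hwf⟩ := h₃ m (f ≫ A.mor₂⟦m⟧')
    obtain ⟨n, hn⟩ := hW hw
    lift w to 𝒜 n using hn
    have hwf' : (f ≫ φ.toEnd (A.obj₂⟦m⟧) w) ≫ A.mor₂⟦m⟧'⟦n⟧' = 0 := by
      rwa [Category.assoc, toEnd_naturality, ← Category.assoc, ← mem_ann_iff]
    -- Once `w` kills the image of `f`, the multiple of `f` by `w` lifts to the first object of the
    -- shifted triangle, where a second element `w'` kills it.
    let B := (Triangle.shiftFunctor T n).obj ((Triangle.shiftFunctor T m).obj A)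
    have hB : B ∈ distTriang T := Triangle.shift_distinguished _ (A.shift_distinguished hA m) n
    have hwf'' : (f ≫ φ.toEnd (A.obj₂⟦m⟧) w) ≫ B.mor₂ = 0 := by
      change _ ≫ (n.negOnePow • (m.negOnePow • A.mor₂⟦m⟧')⟦n⟧') = 0
      rw [Functor.map_units_smul, Linear.comp_units_smul, Linear.comp_units_smul, hwf', smul_zero,
        smul_zero]
    obtain ⟨g, hg⟩ := Triangle.coyoneda_exact₂ B hB _ hwf''
    obtain ⟨w', hw', hwg⟩ := h₁.exists_mem ((shiftFunctorAdd T m n).app A.obj₁) g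
    refine ⟨w' * w, W.mul_mem hw' hw, ?_⟩
    obtain ⟨n', hn'⟩ := hW hw'
    lift w' to 𝒜 n' using hn'
    rw [mul_mem_ann_iff]
    exact hg ▸ φ.ann_le_comp g _ hwg
  · let c := sigmaComparison (shiftFunctor T m) X
    obtain ⟨s, hs⟩ := hC J _ (f ≫ inv c)
    suffices key : ∀ s : Finset J, ∃ w ∈ W, ∀ j ∈ s,
        w ∈ φ.ann ((f ≫ inv c) ≫ sigmaProj (fun j => (X j)⟦m⟧) j) by
      obtain ⟨w, hw, hws⟩ := key s
      refine ⟨w, hw, ?_⟩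
      rw [← φ.ann_comp_iso f (inv c), eq_sum_of_comp_sigmaTrunc_eq_zero hs]
      intro n
      rw [Preadditive.sum_comp]
      exact Finset.sum_eq_zero fun j hj => φ.ann_le_comp _ _ (hws j hj) n
    intro s
    classical
    induction s using Finset.induction_on with
    | empty => exact ⟨1, W.one_mem, by simp⟩
    | insert j s hj ih =>
      obtain ⟨w, hw, hws⟩ := ih
      obtain ⟨w', hw', hws'⟩ := h j m ((f ≫ inv c) ≫ sigmaProj (fun j => (X j)⟦m⟧) j)
      refine ⟨w * w', W.mul_mem hw hw', fun k hk => ?_⟩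
      rcases Finset.mem_insert.1 hk with rfl | hk
      · exact Ideal.mul_mem_left _ _ hws'
      · exact mul_mem_comm hcomm (hW hw') (hW hw) (Ideal.mul_mem_left _ _ (hws k hk))

/-- The hypothesis on the cone makes `r` injective on `Hom^*(C, Y)` localised at `W`, so inverting
`r` as well cannot kill anything new. -/
lemma Van.of_unitCone {n : ℤ} {r : 𝒜 n} {Y : T} (hK : φ.Van W C (unitCone (φ.toHom n r) ⊗ Y))
    (hr : φ.Van (Submonoid.closure (W ∪ {(r : R)})) C Y) : φ.Van W C Y := by
  have key : ∀ w ∈ Submonoid.closure ((W : Set R) ∪ {(r : R)}), IsHomogeneousElem 𝒜 w ∧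
      ∀ (Z : T) (m : ℤ) (_ : Y⟦m⟧ ≅ Z) (f : C ⟶ Z), w ∈ φ.ann f → ∃ w' ∈ W, w' ∈ φ.ann f := by
    intro w hw
    induction hw using Submonoid.closure_induction with
    | mem w hw =>
      rcases hw with hw | rfl
      · exact ⟨hW hw, fun Z m e f hf => ⟨w, hw, hf⟩⟩
      · refine ⟨⟨n, r.2⟩, fun Z m e f hf => ?_⟩
        obtain ⟨g, h, H⟩ := exists_unitCone_distTriang (φ.toHom n r) Z
        rw [mem_ann_iff] at hf
        -- A morphism killed by `r` lifts, after suspension, to the cone of `r`, where some element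
        -- of `W` kills the lift.
        obtain ⟨l, hl⟩ := distTriang_lift₁ H (f⟦(1 : ℤ)⟧') (by
          rw [← Functor.map_comp]
          exact (congrArg (shiftFunctor T (1 : ℤ)).map hf).trans (Functor.map_zero _ _ _))
        let i := (shiftFunctorCompIsoId T (1 : ℤ) (-1) (by simp)).inv.app C
        let e' : (unitCone (φ.toHom n r) ⊗ Y)⟦m + -1⟧ ≅
            (unitCone (φ.toHom n r) ⊗ Z)⟦(-1 : ℤ)⟧ :=
          (shiftFunctorAdd T m (-1)).app _ ≪≫ (shiftFunctor T (-1 : ℤ)).mapIso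
            ((tensorShiftIso _ Y m).symm ≪≫ whiskerLeftIso _ e)
        obtain ⟨w', hw', hwf⟩ := hK.exists_mem e' (i ≫ l⟦(-1 : ℤ)⟧')
        refine ⟨w', hw', ?_⟩
        rw [ann_iso_comp, ann_shift] at hwf
        rw [← φ.ann_shift f 1, hl]
        exact φ.ann_le_comp _ _ hwf
    | one => exact ⟨hW W.one_mem, fun Z m e f hf => ⟨1, W.one_mem, hf⟩⟩
    | mul x y _ _ hx hy =>
      refine ⟨(homogeneousSubmonoid 𝒜).mul_mem hx.1 hy.1, fun Z m e f hf => ?_⟩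
      obtain ⟨⟨i, hi⟩, hx⟩ := hx
      obtain ⟨⟨j, hj⟩, hy⟩ := hy
      lift x to 𝒜 i using hi
      lift y to 𝒜 j using hj
      rw [mul_mem_ann_iff] at hf
      -- Replace `x` by some `w` in `W` killing the multiple of `f` by `y`, exchange `w` and `y`,
      -- then replace `y` in the same way.
      obtain ⟨w, hw, hwf⟩ := hx _ (m + j)
        ((shiftFunctorAdd T m j).app Y ≪≫ (shiftFunctor T j).mapIso e) _ hf
      obtain ⟨k, hk⟩ := hW hw
      lift w to 𝒜 k using hk
      rw [← mul_mem_ann_iff] at hwf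
      have hwf' := mul_mem_comm hcomm ⟨k, w.2⟩ ⟨j, y.2⟩ hwf
      rw [mul_mem_ann_iff] at hwf'
      obtain ⟨w', hw', hwf''⟩ := hy _ (m + k)
        ((shiftFunctorAdd T m k).app Y ≪≫ (shiftFunctor T k).mapIso e) _ hwf'
      obtain ⟨k', hk'⟩ := hW hw'
      lift w' to 𝒜 k' using hk'
      rw [← mul_mem_ann_iff] at hwf''
      exact ⟨_, W.mul_mem hw' hw, hwf''⟩
  intro m f
  obtain ⟨w, hw, hwf⟩ := hr m f
  exact (key w hw).2 _ m (Iso.refl _) f hwf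

end UnitAction

end Torsion

/-! ### Supports, and detection of torsion objects by Koszul objects -/

section Detection

open SetLike

variable {R : Type w} [Ring R] {𝒜 : ℤ → AddSubgroup R} [GradedRing 𝒜]
  {T : Type u} [Category.{v} T] [HasZeroObject T] [HasShift T ℤ] [Preadditive T]
  [∀ n : ℤ, (shiftFunctor T n).Additive] [Pretriangulated T]
  [MonoidalCategory T] [SymmetricCategory T] [(curriedTensor T).CommShift₂Int]
  [IsTensorTriangulated T]

/-- The homogeneous elements outside a homogeneous prime. -/
def homogeneousCompl (q : HomogeneousSpec 𝒜) : Submonoid R where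
  carrier := {x | IsHomogeneousElem 𝒜 x ∧ x ∉ q.1.toIdeal}
  mul_mem' {_ _} hx hy := ⟨(homogeneousSubmonoid 𝒜).mul_mem hx.1 hy.1,
    fun h => (q.2.mem_or_mem h).elim hx.2 hy.2⟩
  one_mem' := ⟨(homogeneousSubmonoid 𝒜).one_mem, fun h => q.2.ne_top ((Ideal.eq_top_iff_one _).2 h)⟩

lemma homogeneousCompl_le (q : HomogeneousSpec 𝒜) :
    homogeneousCompl q ≤ homogeneousSubmonoid 𝒜 := fun _ hx => hx.1

lemma toIdeal_le_of_homogeneousCompl {p q : HomogeneousSpec 𝒜}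
    (h : ∀ w ∈ homogeneousCompl p, w ∉ q.1.toIdeal) : q ≤ p := by
  classical
  intro x hx
  change x ∈ p.1.toIdeal
  rw [← DirectSum.sum_support_decompose 𝒜 x]
  refine Ideal.sum_mem _ fun i _ => ?_
  by_contra hi
  exact h _ ⟨⟨i, SetLike.coe_mem _⟩, hi⟩ (q.1.isHomogeneous i hx)

namespace UnitAction

variable {φ : UnitAction 𝒜 T}

lemma homLocalisationVanishes_iff {C Y : T} {q : HomogeneousSpec 𝒜} :
    φ.HomLocalisationVanishes C Y q ↔ φ.Van (homogeneousCompl q) C Y := by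
  refine forall_congr' fun m => forall_congr' fun f => ⟨?_, ?_⟩
  · rintro ⟨n, r, hr, h⟩
    exact ⟨r, ⟨⟨n, r.2⟩, hr⟩, (φ.smul_eq_zero_iff r f).1 h⟩
  · rintro ⟨w, ⟨⟨n, hn⟩, hw⟩, h⟩
    exact ⟨n, ⟨w, hn⟩, hw, (φ.smul_eq_zero_iff ⟨w, hn⟩ f).2 h⟩

/-- If no element of `W` kills `f`, its annihilator lies in a homogeneous prime missing `W`, and `f`
survives localisation there. -/
lemma exists_not_van [IsNoetherianRing R] (hcomm : IsGradedCommutative 𝒜) {W : Submonoid R}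
    {C Y : T} (h : ¬ φ.Van W C Y) :
    ∃ q : HomogeneousSpec 𝒜, (∀ w ∈ W, w ∉ q.1.toIdeal) ∧
      ¬ φ.Van (homogeneousCompl q) C Y := by
  simp only [Van, not_forall, not_exists, not_and] at h
  obtain ⟨m, f, hf⟩ := h
  obtain ⟨q, hq, hqW⟩ := exists_homogeneousSpec_disjoint hcomm (φ.isHomogeneous_ann f) W hf
  refine ⟨q, hqW, fun h => ?_⟩
  obtain ⟨w, hw, hwf⟩ := h m f
  exact hw.2 (hq hwf)

variable (φ) in
/-- The Koszul object of a list of homogeneous elements of `R`. -/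
noncomputable def koszulOf (l : List (Σ n : ℤ, 𝒜 n)) : T :=
  koszul (l.map fun a => ⟨a.1, φ.toHom a.1 a.2⟩)

lemma van_unitCone {W : Submonoid R} {n : ℤ} {r : 𝒜 n} (hr : (r : R) ∈ W) (C X : T) :
    φ.Van W C (unitCone (φ.toHom n r) ⊗ X) := by
  intro m f
  refine ⟨_, W.mul_mem hr hr, ?_⟩
  rw [← φ.ann_comp_iso f (tensorShiftIso _ X m).inv, mul_mem_ann_iff, mem_ann_iff, Category.assoc]
  exact (congrArg _ (unitEnd_comp_self_unitCone (φ.toHom n r) (X⟦m⟧))).trans comp_zero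

variable [HasCoproducts.{v} T] (hcomm : IsGradedCommutative 𝒜)
include hcomm

lemma isLocalising_torsion (V : Set (HomogeneousSpec 𝒜)) : IsLocalising (φ.torsion V) := by
  have h (C : T) (hC : IsCompactObj C) (q : HomogeneousSpec 𝒜) :=
    isLocalising_van (φ := φ) hcomm (homogeneousCompl_le q) hC.isFinitary
  simp only [← homLocalisationVanishes_iff] at h
  exact .mk' (fun _ _ e hX C hC q hq => (h C hC q).of_iso e (hX C hC q hq))
    (fun _ hX C hC q _ => (h C hC q).zero hX)
    (fun _ n hX C hC q hq => (h C hC q).shift (hX C hC q hq) n)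
    (fun _ hA h₁ h₃ C hC q hq => (h C hC q).ext₂ hA (h₁ C hC q hq) (h₃ C hC q hq))
    (fun _ X hX C hC q hq => (h C hC q).sigma X fun j => hX j C hC q hq)

/-- For `q` outside `V`, some generator of `p` lies outside `q`. It becomes invertible at `q`, while
its square annihilates every morphism into the cone. -/
lemma torsion_koszulOf {V : Set (HomogeneousSpec 𝒜)} (hV : ∀ p ∈ V, ∀ q, p ≤ q → q ∈ V)
    {p : HomogeneousSpec 𝒜} (hp : p ∈ V) {l : List (Σ n : ℤ, 𝒜 n)}
    (hl : Ideal.span {x | ∃ a ∈ l, x = (a.2 : R)} = p.1.toIdeal) (X : T) :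
    φ.torsion V (φ.koszulOf l ⊗ X) := by
  intro C hC q hq
  rw [homLocalisationVanishes_iff]
  have hS := isLocalising_van (φ := φ) hcomm (homogeneousCompl_le q) hC.isFinitary
  obtain ⟨a, ha, haq⟩ : ∃ a ∈ l, (a.2 : R) ∉ q.1.toIdeal := by
    by_contra! h
    refine hq (hV p hp q ?_)
    change p.1.toIdeal ≤ q.1.toIdeal
    rw [← hl, Ideal.span_le]
    rintro _ ⟨a, ha, rfl⟩
    exact h a ha
  clear hl
  unfold koszulOf
  induction l with
  | nil => simp at ha
  | cons b l ih =>
    refine hS.of_iso (α_ _ _ _).symm ?_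
    rcases List.mem_cons.1 ha with rfl | ha
    · exact van_unitCone (W := homogeneousCompl q) ⟨⟨a.1, a.2.2⟩, haq⟩ C _
    · obtain ⟨g, c, H⟩ := exists_unitCone_distTriang (φ.toHom b.1 b.2) (φ.koszulOf l ⊗ X)
      exact hS.ext₃ H (ih ha) (hS.shift (ih ha) _)

/-- A torsion object is zero if its Koszul objects vanish. -/
theorem isZero_of_torsion [IsNoetherianRing R] (hdim : HasFiniteKrullDim 𝒜)
    (hT : IsCompactlyGenerated T) {V : Set (HomogeneousSpec 𝒜)} {Y : T} (hY : φ.torsion V Y)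
    (h : ∀ p ∈ V, ∀ l : List (Σ n : ℤ, 𝒜 n),
      Ideal.span {x | ∃ a ∈ l, x = (a.2 : R)} = p.1.toIdeal → IsZero (φ.koszulOf l ⊗ Y)) :
    IsZero Y := by
  obtain ⟨ι, G, hG, hG'⟩ := hT
  refine hG' Y fun i => ?_
  suffices hv : φ.Van ⊥ (G i) Y by
    intro n f
    obtain ⟨w, hw, hwf⟩ := hv n f
    rw [Submonoid.mem_bot.1 hw, one_mem_ann_iff] at hwf
    exact hwf
  by_contra hv
  obtain ⟨p₀, -, hp₀⟩ := exists_not_van hcomm hv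
  -- A minimal prime of the support of `Hom^*(G i, Y)`; it lies in `V` because `Y` is torsion.
  obtain ⟨p, hp, hmin⟩ := (wellFounded_homogeneousSpec hdim).has_min
    {q | ¬ φ.Van (homogeneousCompl q) (G i) Y} ⟨p₀, hp₀⟩
  have hpV : p ∈ V := by
    by_contra hpV
    exact hp (homLocalisationVanishes_iff.1 (hY _ (hG i) p hpV))
  obtain ⟨l, hl⟩ := exists_list_span_eq p.1.isHomogeneous
  have hlp : ∀ a ∈ l, (a.2 : R) ∈ p.1.toIdeal := fun a ha => by
    rw [← hl]
    exact Ideal.subset_span ⟨a, ha, rfl⟩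
  have hS := isLocalising_van (φ := φ) hcomm (homogeneousCompl_le p) (hG i).isFinitary
  refine hp ?_
  have hz := hS.zero (h p hpV l hl)
  unfold koszulOf at hz
  clear hl
  induction l with
  | nil => exact hS.of_iso (λ_ Y) hz
  | cons a l ih =>
    -- Strip off one generator `a` of `p`. A prime of the support surviving the inversion of `a` and
    -- of the complement of `p` would lie strictly below `p`, against minimality.
    refine ih (fun b hb => hlp b (by simp [hb])) (Van.of_unitCone hcomm (homogeneousCompl_le p)
      (hS.of_iso (α_ _ _ _) hz) ?_)
    have hle : Submonoid.closure ((homogeneousCompl p : Set R) ∪ {(a.2 : R)}) ≤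
        homogeneousSubmonoid 𝒜 := by
      rw [Submonoid.closure_le]
      rintro _ (hx | rfl)
      · exact hx.1
      · exact ⟨a.1, a.2.2⟩
    refine (isLocalising_van hcomm hle (hG i).isFinitary).koszul_tensor _ ?_
    by_contra hv
    obtain ⟨q, hq, hqv⟩ := exists_not_van hcomm hv
    refine hmin q hqv (lt_of_le_of_ne (toIdeal_le_of_homogeneousCompl fun w hw =>
      hq w (Submonoid.subset_closure (Or.inl hw))) ?_)
    rintro rfl
    exact hq _ (Submonoid.subset_closure (Or.inr rfl)) (hlp a (by simp))

end UnitAction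

end Detection

section Reflections

/-! ### Adjoints of inclusions of full subcategories -/

variable {T : Type u} [Category.{v} T] (P : ObjectProperty T)

/-- `gammaV` and `locV` use unspecified adjoints; one universal arrow at `X` determines their value
there up to isomorphism. -/
lemma nonempty_isTerminal {A X : T} (hA : P A) (a : A ⟶ X)
    (h : ∀ B, P B → ∀ k : B ⟶ X, ∃! l : B ⟶ A, l ≫ a = k) :
    Nonempty (IsTerminal (CostructuredArrow.mk (S := P.ι) (Y := ⟨A, hA⟩) a)) := by
  choose l hl hl' using h
  exact ⟨IsTerminal.ofUniqueHom
    (fun B => CostructuredArrow.homMk (ObjectProperty.homMk (l _ B.left.2 B.hom)) (hl _ _ _))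
    (fun B m => CostructuredArrow.hom_ext _ _ (ObjectProperty.hom_ext _
      (hl' _ _ _ m.left.hom (CostructuredArrow.w m))))⟩

lemma isLeftAdjoint_ι (h : ∀ X, ∃ (A : T) (_ : P A) (a : A ⟶ X),
    ∀ B, P B → ∀ k : B ⟶ X, ∃! l : B ⟶ A, l ≫ a = k) : P.ι.IsLeftAdjoint := by
  rw [isLeftAdjoint_iff_hasTerminal_costructuredArrow]
  intro X
  obtain ⟨A, hA, a, ha⟩ := h X
  exact (nonempty_isTerminal P hA a ha).some.hasTerminal

lemma nonempty_rightAdjoint_iso [P.ι.IsLeftAdjoint] {A X : T} (hA : P A) (a : A ⟶ X)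
    (h : ∀ B, P B → ∀ k : B ⟶ X, ∃! l : B ⟶ A, l ≫ a = k) :
    Nonempty ((P.ι.rightAdjoint ⋙ P.ι).obj X ≅ A) :=
  ⟨(CostructuredArrow.proj P.ι X ⋙ P.ι).mapIso
    ((mkTerminalOfRightAdjoint _ (Adjunction.ofIsLeftAdjoint P.ι) X).uniqueUpToIso
      (nonempty_isTerminal P hA a h).some)⟩

lemma nonempty_isInitial {B X : T} (hB : P B) (b : X ⟶ B)
    (h : ∀ A, P A → ∀ k : X ⟶ A, ∃! l : B ⟶ A, b ≫ l = k) :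
    Nonempty (IsInitial (StructuredArrow.mk (T := P.ι) (Y := ⟨B, hB⟩) b)) := by
  choose l hl hl' using h
  exact ⟨IsInitial.ofUniqueHom
    (fun A => StructuredArrow.homMk (ObjectProperty.homMk (l _ A.right.2 A.hom)) (hl _ _ _))
    (fun A m => StructuredArrow.hom_ext _ _ (ObjectProperty.hom_ext _
      (hl' _ _ _ m.right.hom (StructuredArrow.w m))))⟩

lemma isRightAdjoint_ι (h : ∀ X, ∃ (B : T) (_ : P B) (b : X ⟶ B),
    ∀ A, P A → ∀ k : X ⟶ A, ∃! l : B ⟶ A, b ≫ l = k) : P.ι.IsRightAdjoint := by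
  rw [isRightAdjoint_iff_hasInitial_structuredArrow]
  intro X
  obtain ⟨B, hB, b, hb⟩ := h X
  exact (nonempty_isInitial P hB b hb).some.hasInitial

lemma nonempty_leftAdjoint_iso [P.ι.IsRightAdjoint] {B X : T} (hB : P B) (b : X ⟶ B)
    (h : ∀ A, P A → ∀ k : X ⟶ A, ∃! l : B ⟶ A, b ≫ l = k) :
    Nonempty ((P.ι.leftAdjoint ⋙ P.ι).obj X ≅ B) :=
  ⟨(StructuredArrow.proj X P.ι ⋙ P.ι).mapIso
    ((mkInitialOfLeftAdjoint _ (Adjunction.ofIsRightAdjoint P.ι) X).uniqueUpToIso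
      (nonempty_isInitial P hB b h).some)⟩

end Reflections

/-! ### Localisation triangles of the unit and the functors they represent -/

section LocalisationTriangle

variable {R : Type w} [Ring R] {𝒜 : ℤ → AddSubgroup R} [GradedRing 𝒜]
  {T : Type u} [Category.{v} T] [HasZeroObject T] [HasShift T ℤ] [Preadditive T]
  [∀ n : ℤ, (shiftFunctor T n).Additive] [Pretriangulated T]
  [MonoidalCategory T] [SymmetricCategory T] [(curriedTensor T).CommShift₂Int]
  [IsCompactlyGeneratedTensorTriangulated T]

instance : HasCoproducts.{v} T := IsCompactlyGeneratedTensorTriangulated.hasCoproducts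

lemma IsLocalising.tensorRight {S : ObjectProperty T} (hS : IsLocalising S) (X : T) :
    IsLocalising (fun A => S (A ⊗ X)) := by
  have := IsTensorTriangulated.tensorRight_exact X
  exact hS.inverseImage (MonoidalCategory.tensorRight X)
    (IsCompactlyGeneratedTensorTriangulated.tensorRight_coproducts X)

lemma IsLocalising.tensorLeft {S : ObjectProperty T} (hS : IsLocalising S) (X : T) :
    IsLocalising (fun A => S (X ⊗ A)) := by
  have := IsTensorTriangulated.tensorLeft_exact X
  exact hS.inverseImage (MonoidalCategory.tensorLeft X)
    (IsCompactlyGeneratedTensorTriangulated.tensorLeft_coproducts X)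

lemma isZero_tensor {A : T} (hA : IsZero A) (X : T) : IsZero (A ⊗ X) :=
  (IsLocalising.isZero.tensorRight X).zero hA

lemma isFinitary_unit : IsFinitary (𝟙_ T) :=
  (IsCompactlyGeneratedTensorTriangulated.isCompactObj_unit (T := T)).isFinitary

/-- The objects left orthogonal to `Y` form a localising subcategory containing `𝟙`, hence `Y`
itself, so its identity is zero. -/
lemma isZero_of_mem_loc_unit {Y : T} (hY : loc (ObjectProperty.singleton (𝟙_ T)) Y)
    (h : Orth (𝟙_ T) Y) : IsZero Y := by
  rw [IsZero.iff_id_eq_zero]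
  exact (hY _ (isLocalising_orth_left Y) (by rintro _ ⟨⟩; exact h)).eq_zero (𝟙 Y)

/-- The exchange isomorphism `A ⊗ B ⊗ X ≅ B ⊗ A ⊗ X`. -/
noncomputable def tensorLeftComm (A B X : T) : A ⊗ B ⊗ X ≅ B ⊗ A ⊗ X :=
  (α_ A B X).symm ≪≫ whiskerRightIso (β_ A B) X ≪≫ α_ B A X

variable (φ : UnitAction 𝒜 T)

/-- The localisation triangle `Γ ⟶ 𝟙 ⟶ L ⟶` of the tensor unit at a set of homogeneous primes. -/
structure UnitAction.LocalisationTriangle (V : Set (HomogeneousSpec 𝒜)) where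
  /-- the acyclic part of the unit -/
  Γ : T
  /-- the local part of the unit -/
  L : T
  /-- the map to the unit -/
  f : Γ ⟶ 𝟙_ T
  /-- the map from the unit -/
  g : 𝟙_ T ⟶ L
  /-- the connecting map -/
  h : L ⟶ Γ⟦(1 : ℤ)⟧
  dist : Triangle.mk f g h ∈ distTriang T
  mem : ∀ S : ObjectProperty T, IsLocalising S → (∀ p ∈ V, ∀ l : List (Σ n : ℤ, 𝒜 n),
    Ideal.span {x | ∃ a ∈ l, x = (a.2 : R)} = p.1.toIdeal → S (φ.koszulOf l)) → S Γ
  isZero : ∀ p ∈ V, ∀ l : List (Σ n : ℤ, 𝒜 n),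
    Ideal.span {x | ∃ a ∈ l, x = (a.2 : R)} = p.1.toIdeal → IsZero (φ.koszulOf l ⊗ L)

lemma mem_loc_singleton (X : T) : loc (ObjectProperty.singleton X) X :=
  subset_loc _ _ (by simp)

lemma UnitAction.koszulOf_mem_loc_unit (l : List (Σ n : ℤ, 𝒜 n)) :
    loc (ObjectProperty.singleton (𝟙_ T)) (φ.koszulOf l) :=
  (isLocalising_loc _).of_iso (ρ_ _) ((isLocalising_loc _).koszul_tensor _
    (mem_loc_singleton _))

/-- Self-duality turns `Hom^*(K, L) = 0` into `Hom^*(𝟙, K ⊗ L) = 0`, and `K ⊗ L` lies in `Loc(𝟙)`,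
so it vanishes. -/
theorem UnitAction.nonempty_localisationTriangle (V : Set (HomogeneousSpec 𝒜)) :
    Nonempty (φ.LocalisationTriangle V) := by
  -- Lists of endomorphisms of `𝟙`, not of elements of `R`, keep the index type in the universe `v`
  -- of the coproducts.
  let ι := {l : List (Σ n : ℤ, ShiftedHom (𝟙_ T) (𝟙_ T) n) //
    ∃ p ∈ V, ∃ l' : List (Σ n : ℤ, 𝒜 n),
      Ideal.span {x | ∃ a ∈ l', x = (a.2 : R)} = p.1.toIdeal ∧
        l = l'.map fun a => ⟨a.1, φ.toHom a.1 a.2⟩}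
  let G : ι → T := fun l => koszul l.1
  obtain ⟨A, B, f, g, h, H, hA, hB⟩ := exists_triangle_locOf G
    (fun l => isFinitary_unit.koszul l.1) (𝟙_ T)
  have hloc := isLocalising_loc (ObjectProperty.singleton (𝟙_ T))
  have mem : ∀ S : ObjectProperty T, IsLocalising S → (∀ p ∈ V, ∀ l : List (Σ n : ℤ, 𝒜 n),
      Ideal.span {x | ∃ a ∈ l, x = (a.2 : R)} = p.1.toIdeal → S (φ.koszulOf l)) → S A := by
    intro S hS hSl
    refine locOf_le G hS ?_ A hA
    rintro ⟨_, p, hp, l', hl', rfl⟩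
    exact hSl p hp l' hl'
  have hBloc : loc (ObjectProperty.singleton (𝟙_ T)) B :=
    hloc.ext₃ H (mem _ hloc fun p _ l _ => φ.koszulOf_mem_loc_unit l) (mem_loc_singleton _)
  refine ⟨⟨A, B, f, g, h, H, mem, fun p hp l hl => ?_⟩⟩
  refine isZero_of_mem_loc_unit (hloc.koszul_tensor _ hBloc) (Orth.of_koszul_left _ ?_)
  exact (hB _ (mem_locOf G ⟨_, p, hp, l, hl, rfl⟩)).of_iso_left (ρ_ _).symm

namespace UnitAction.LocalisationTriangle

variable {φ} {V : Set (HomogeneousSpec 𝒜)} (t : φ.LocalisationTriangle V)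

lemma mem_loc_unit_Γ : loc (ObjectProperty.singleton (𝟙_ T)) t.Γ :=
  t.mem _ (isLocalising_loc _) fun _ _ l _ => φ.koszulOf_mem_loc_unit l

lemma mem_loc_unit_L : loc (ObjectProperty.singleton (𝟙_ T)) t.L :=
  (isLocalising_loc _).ext₃ t.dist t.mem_loc_unit_Γ (mem_loc_singleton _)

lemma exists_triangle (X : T) : ∃ (a : t.Γ ⊗ X ⟶ X) (b : X ⟶ t.L ⊗ X)
    (c : t.L ⊗ X ⟶ (t.Γ ⊗ X)⟦(1 : ℤ)⟧), Triangle.mk a b c ∈ distTriang T := by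
  have := IsTensorTriangulated.tensorRight_exact X
  have H' := (MonoidalCategory.tensorRight X).map_distinguished _ t.dist
  refine ⟨t.f ▷ X ≫ (λ_ X).hom, (λ_ X).inv ≫ t.g ▷ X,
    t.h ▷ X ≫ (shiftTensorIso t.Γ X 1).hom,
    isomorphic_distinguished _ H' _ (Triangle.isoMk _ _ (Iso.refl _) (λ_ X).symm (Iso.refl _)
      ?_ ?_ ?_)⟩
  · change (t.f ▷ X ≫ (λ_ X).hom) ≫ (λ_ X).inv = 𝟙 _ ≫ t.f ▷ X
    simp
  · exact Category.comp_id _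
  · change (t.h ▷ X ≫ (shiftTensorIso t.Γ X 1).hom) ≫ (𝟙 _)⟦(1 : ℤ)⟧' =
      𝟙 _ ≫ t.h ▷ X ≫ (shiftTensorIso t.Γ X 1).hom
    simp

variable (hV : ∀ p ∈ V, ∀ q, p ≤ q → q ∈ V) (hcomm : IsGradedCommutative 𝒜)

include hV hcomm in
lemma torsion_Γ (X : T) : φ.torsion V (t.Γ ⊗ X) :=
  t.mem (fun A => φ.torsion V (A ⊗ X)) ((isLocalising_torsion hcomm V).tensorRight X)
    fun _ hp _ hl => torsion_koszulOf hcomm hV hp hl X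

variable [IsNoetherianRing R] (hdim : HasFiniteKrullDim 𝒜)
include t hV hcomm hdim

/-- `L ⊗ X` is the cone of a morphism of torsion objects, and it is annihilated by the Koszul
objects that detect torsion objects. -/
lemma isZero_L_of_torsion {X : T} (hX : φ.torsion V X) : IsZero (t.L ⊗ X) := by
  obtain ⟨a, b, c, H⟩ := t.exists_triangle X
  refine isZero_of_torsion hcomm hdim
    IsCompactlyGeneratedTensorTriangulated.isCompactlyGenerated
    ((isLocalising_torsion hcomm V).ext₃ H (t.torsion_Γ hV hcomm X) hX) fun p hp l hl => ?_
  exact (isZero_tensor (t.isZero p hp l hl) X).of_iso (α_ _ _ _).symm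

lemma locals_of_koszul {Y : T} (hY : ∀ p ∈ V, ∀ l : List (Σ n : ℤ, 𝒜 n),
    Ideal.span {x | ∃ a ∈ l, x = (a.2 : R)} = p.1.toIdeal → IsZero (φ.koszulOf l ⊗ Y)) :
    φ.locals V Y := by
  intro A k hA
  obtain ⟨a, b, c, H⟩ := t.exists_triangle A
  have ho : Orth (t.Γ ⊗ A) Y := by
    refine t.mem (fun B => Orth (B ⊗ A) Y) ((isLocalising_orth_left Y).tensorRight A)
      fun p hp l hl => Orth.koszul_left _ fun n f => ?_
    exact ((shiftFunctor T n).map_isZero (hY p hp l hl)).eq_of_tgt _ _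
  obtain ⟨l, rfl⟩ := distTriang_desc₂ H k (ho.eq_zero _)
  rw [(t.isZero_L_of_torsion hV hcomm hdim hA).eq_zero_of_src l, comp_zero]

lemma locals_L (X : T) : φ.locals V (t.L ⊗ X) :=
  t.locals_of_koszul hV hcomm hdim fun p hp l hl =>
    (isZero_tensor (t.isZero p hp l hl) X).of_iso (α_ _ _ _).symm

lemma torsion_iff {X : T} : φ.torsion V X ↔ IsZero (t.L ⊗ X) := by
  refine ⟨t.isZero_L_of_torsion hV hcomm hdim, fun h => ?_⟩
  obtain ⟨a, b, c, H⟩ := t.exists_triangle X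
  have hT := isLocalising_torsion (φ := φ) hcomm V
  exact hT.ext₂ H (t.torsion_Γ hV hcomm X) (hT.zero h)

lemma coreflection {X A : T} {a : t.Γ ⊗ X ⟶ X} {b : X ⟶ t.L ⊗ X}
    {c : t.L ⊗ X ⟶ (t.Γ ⊗ X)⟦(1 : ℤ)⟧} (H : Triangle.mk a b c ∈ distTriang T)
    (hA : φ.torsion V A) (k : A ⟶ X) : ∃! l : A ⟶ t.Γ ⊗ X, l ≫ a = k := by
  have hL := t.locals_L hV hcomm hdim X
  obtain ⟨l, hl⟩ := distTriang_lift₂ H k (hL _ hA)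
  refine ⟨l, hl.symm, fun l' hl' => ?_⟩
  have h₀ : (l' - l) ≫ a = 0 := by rw [Preadditive.sub_comp, hl', ← hl, sub_self]
  obtain ⟨m, hm⟩ := distTriang_lift₁ H ((l' - l)⟦(1 : ℤ)⟧') (by
    rw [← Functor.map_comp, h₀, Functor.map_zero])
  rw [hL m ((isLocalising_torsion hcomm V).shift hA 1), zero_comp] at hm
  exact sub_eq_zero.1 ((shiftFunctor T (1 : ℤ)).map_eq_zero_iff.1 hm)

lemma reflection {X Y : T} {a : t.Γ ⊗ X ⟶ X} {b : X ⟶ t.L ⊗ X}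
    {c : t.L ⊗ X ⟶ (t.Γ ⊗ X)⟦(1 : ℤ)⟧} (H : Triangle.mk a b c ∈ distTriang T)
    (hY : φ.locals V Y) (k : X ⟶ Y) : ∃! l : t.L ⊗ X ⟶ Y, b ≫ l = k := by
  have hΓ := t.torsion_Γ hV hcomm X
  obtain ⟨l, hl⟩ := distTriang_desc₂ H k (hY _ hΓ)
  refine ⟨l, hl.symm, fun l' hl' => ?_⟩
  have h₀ : b ≫ (l' - l) = 0 := by rw [Preadditive.comp_sub, hl', ← hl, sub_self]
  obtain ⟨m, hm⟩ := distTriang_desc₃ H _ h₀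
  rw [hY m ((isLocalising_torsion hcomm V).shift hΓ 1), comp_zero] at hm
  exact sub_eq_zero.1 hm

lemma locals_iff {X : T} : φ.locals V X ↔ IsZero (t.Γ ⊗ X) := by
  obtain ⟨a, b, c, H⟩ := t.exists_triangle X
  constructor
  · intro h
    have hΓ := t.torsion_Γ hV hcomm X
    rw [IsZero.iff_id_eq_zero]
    -- The morphism `a` from a torsion to a local object is zero, so the identity and zero both lift
    -- the zero map.
    exact (t.coreflection hV hcomm hdim H hΓ 0).unique
      (by rw [Category.id_comp, h a hΓ]) zero_comp
  · intro h A k hA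
    refine (t.coreflection hV hcomm hdim H hA k).exists.elim fun l hl => ?_
    rw [← hl, h.eq_zero_of_tgt l, zero_comp]

lemma isLeftAdjoint : (φ.torsion V).ι.IsLeftAdjoint :=
  isLeftAdjoint_ι _ fun X => by
    obtain ⟨a, b, c, H⟩ := t.exists_triangle X
    exact ⟨_, t.torsion_Γ hV hcomm X, a, fun A hA k => t.coreflection hV hcomm hdim H hA k⟩

lemma isRightAdjoint : (φ.locals V).ι.IsRightAdjoint :=
  isRightAdjoint_ι _ fun X => by
    obtain ⟨a, b, c, H⟩ := t.exists_triangle X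
    exact ⟨_, t.locals_L hV hcomm hdim X, b, fun A hA k => t.reflection hV hcomm hdim H hA k⟩

lemma nonempty_gammaV_iso (X : T) : Nonempty ((φ.gammaV V).obj X ≅ t.Γ ⊗ X) := by
  have h := t.isLeftAdjoint hV hcomm hdim
  obtain ⟨a, b, c, H⟩ := t.exists_triangle X
  rw [gammaV, dif_pos h]
  exact nonempty_rightAdjoint_iso _ (t.torsion_Γ hV hcomm X) a
    fun A hA k => t.coreflection hV hcomm hdim H hA k

lemma nonempty_locV_iso (X : T) : Nonempty ((φ.locV V).obj X ≅ t.L ⊗ X) := by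
  have h := t.isRightAdjoint hV hcomm hdim
  obtain ⟨a, b, c, H⟩ := t.exists_triangle X
  rw [locV, dif_pos h]
  exact nonempty_leftAdjoint_iso _ (t.locals_L hV hcomm hdim X) b
    fun A hA k => t.reflection hV hcomm hdim H hA k

lemma nonempty_Γ_iso {X : T} (hX : φ.torsion V X) : Nonempty (t.Γ ⊗ X ≅ X) := by
  obtain ⟨a, b, c, H⟩ := t.exists_triangle X
  have : IsIso a := (Triangle.isZero₃_iff_isIso₁ _ H).1 ((t.torsion_iff hV hcomm hdim).1 hX)
  exact ⟨asIso a⟩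

lemma nonempty_L_iso {X : T} (hX : φ.locals V X) : Nonempty (t.L ⊗ X ≅ X) := by
  obtain ⟨a, b, c, H⟩ := t.exists_triangle X
  have : IsIso b := (Triangle.isZero₁_iff_isIso₂ _ H).1 ((t.locals_iff hV hcomm hdim).1 hX)
  exact ⟨(asIso b).symm⟩

end UnitAction.LocalisationTriangle

end LocalisationTriangle

section LocalCohomology

/-! ### Local cohomology as tensoring with an object of `Loc(𝟙)` -/

lemma closedSet_specialisationClosed {R : Type w} [Ring R] {𝒜 : ℤ → AddSubgroup R} [GradedRing 𝒜]
    (p : HomogeneousSpec 𝒜) : ∀ q ∈ closedSet p, ∀ q', q ≤ q' → q' ∈ closedSet p :=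
  fun _ hq _ h => le_trans hq h

lemma nonGeneralisations_specialisationClosed {R : Type w} [Ring R] {𝒜 : ℤ → AddSubgroup R}
    [GradedRing 𝒜] (p : HomogeneousSpec 𝒜) :
    ∀ q ∈ nonGeneralisations p, ∀ q', q ≤ q' → q' ∈ nonGeneralisations p :=
  fun _ hq _ h h' => hq (le_trans h h')

variable {R : Type w} [Ring R] {𝒜 : ℤ → AddSubgroup R} [GradedRing 𝒜]
  {T : Type u} [Category.{v} T] [HasZeroObject T] [HasShift T ℤ] [Preadditive T]
  [∀ n : ℤ, (shiftFunctor T n).Additive] [Pretriangulated T]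
  [MonoidalCategory T] [SymmetricCategory T] [(curriedTensor T).CommShift₂Int]
  [IsCompactlyGeneratedTensorTriangulated T]

lemma exists_triangle_loc_unit (X : T) : ∃ (A B : T) (f : A ⟶ X) (g : X ⟶ B)
    (h : B ⟶ A⟦(1 : ℤ)⟧), Triangle.mk f g h ∈ distTriang T ∧
      loc (ObjectProperty.singleton (𝟙_ T)) A ∧ Orth (𝟙_ T) B := by
  let G : PUnit.{v + 1} → T := fun _ => 𝟙_ T
  obtain ⟨A, B, f, g, h, H, hA, hB⟩ := exists_triangle_locOf G (fun _ => isFinitary_unit) X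
  exact ⟨A, B, f, g, h, H, locOf_le G (isLocalising_loc _) (fun _ => mem_loc_singleton _) A hA,
    hB _ (mem_locOf G ⟨⟩)⟩

variable [IsNoetherianRing R] (hcomm : IsGradedCommutative 𝒜) (hdim : HasFiniteKrullDim 𝒜)
  (φ : UnitAction 𝒜 T) (p : HomogeneousSpec 𝒜)
include hcomm hdim

theorem UnitAction.hasLocalCohomology : φ.HasLocalCohomology p :=
  ⟨(φ.nonempty_localisationTriangle _).some.isLeftAdjoint (closedSet_specialisationClosed p)
    hcomm hdim,
  (φ.nonempty_localisationTriangle _).some.isRightAdjoint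
    (nonGeneralisations_specialisationClosed p) hcomm hdim⟩

/-- The functor `Γ_p` is given by tensoring with an object of `Loc(𝟙)`, it restricts to the identity
on `Γ_p T`, and `Γ_p T` is a localising tensor ideal. -/
theorem UnitAction.exists_gamma_iso : ∃ E : T, loc (ObjectProperty.singleton (𝟙_ T)) E ∧
    (∀ X, Nonempty ((φ.gamma p).obj X ≅ E ⊗ X)) ∧ IsLocalising (φ.gammaT p) ∧
    IsTensorIdeal (φ.gammaT p) ∧ ∀ X, φ.gammaT p X → Nonempty (E ⊗ X ≅ X) := by
  have hV := closedSet_specialisationClosed p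
  have hZ := nonGeneralisations_specialisationClosed p
  obtain ⟨t⟩ := φ.nonempty_localisationTriangle (closedSet p)
  obtain ⟨s⟩ := φ.nonempty_localisationTriangle (nonGeneralisations p)
  have hγ (X : T) : Nonempty ((φ.gamma p).obj X ≅ (t.Γ ⊗ s.L) ⊗ X) := by
    obtain ⟨e⟩ := t.nonempty_gammaV_iso hV hcomm hdim ((φ.locV (nonGeneralisations p)).obj X)
    obtain ⟨e'⟩ := s.nonempty_locV_iso hZ hcomm hdim X
    exact ⟨e ≪≫ whiskerLeftIso _ e' ≪≫ (α_ _ _ _).symm⟩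
  have hid (X : T) (h₁ : φ.torsion (closedSet p) X) (h₂ : φ.locals (nonGeneralisations p) X) :
      Nonempty ((t.Γ ⊗ s.L) ⊗ X ≅ X) := by
    obtain ⟨e⟩ := t.nonempty_Γ_iso hV hcomm hdim h₁
    obtain ⟨e'⟩ := s.nonempty_L_iso hZ hcomm hdim h₂
    exact ⟨α_ _ _ _ ≪≫ whiskerLeftIso _ e' ≪≫ e⟩
  -- As a common kernel of tensor functors, `Γ_p T` is visibly localising and a tensor ideal.
  have hiff (X : T) : φ.gammaT p X ↔ IsZero (t.L ⊗ X) ∧ IsZero (s.Γ ⊗ X) := by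
    rw [← t.torsion_iff hV hcomm hdim, ← s.locals_iff hZ hcomm hdim]
    constructor
    · rintro ⟨Y, ⟨e⟩⟩
      obtain ⟨e'⟩ := hγ Y
      let e'' : t.Γ ⊗ (s.L ⊗ Y) ≅ X := (α_ _ _ _).symm ≪≫ e'.symm ≪≫ e
      refine ⟨(isLocalising_torsion hcomm _).of_iso e'' (t.torsion_Γ hV hcomm _), ?_⟩
      rw [s.locals_iff hZ hcomm hdim]
      -- Locality for `Z(p)` survives tensoring with `t.Γ`, since `s.Γ` can be moved past it to meet
      -- `s.L ⊗ Y`.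
      have h₀ := (s.locals_iff hZ hcomm hdim).1 (s.locals_L hZ hcomm hdim Y)
      exact ((IsLocalising.isZero.tensorLeft t.Γ).zero h₀).of_iso
        (whiskerLeftIso _ e''.symm ≪≫ tensorLeftComm _ _ _)
    · rintro ⟨h₁, h₂⟩
      obtain ⟨e⟩ := hγ X
      obtain ⟨e'⟩ := hid X h₁ h₂
      exact ⟨X, ⟨e ≪≫ e'⟩⟩
  have heq : φ.gammaT p = (fun X => IsZero (t.L ⊗ X)) ⊓ (fun X => IsZero (s.Γ ⊗ X)) := by
    ext X
    exact hiff X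
  refine ⟨t.Γ ⊗ s.L, ?_, hγ, ?_, fun X Y hX => ?_, fun X hX => ?_⟩
  · exact t.mem_loc_unit_Γ _ ((isLocalising_loc _).tensorRight _) (by
      rintro _ ⟨⟩
      exact (isLocalising_loc _).of_iso (λ_ _).symm s.mem_loc_unit_L)
  · rw [heq]
    exact (IsLocalising.isZero.tensorLeft _).inf (IsLocalising.isZero.tensorLeft _)
  · rw [hiff] at hX ⊢
    exact ⟨(isZero_tensor hX.1 Y).of_iso (α_ _ _ _).symm,
      (isZero_tensor hX.2 Y).of_iso (α_ _ _ _).symm⟩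
  · rw [hiff] at hX
    exact hid X ((t.torsion_iff hV hcomm hdim).2 hX.1) ((s.locals_iff hZ hcomm hdim).2 hX.2)

end LocalCohomology

end BIK

/-! ### The proposition -/

theorem mainTheorem5
    {T : Type u} [Category.{v} T] [HasZeroObject T] [HasShift T ℤ] [Preadditive T]
    [∀ n : ℤ, (shiftFunctor T n).Additive] [Pretriangulated T] [IsTriangulated T]
    [MonoidalCategory T] [SymmetricCategory T] [(curriedTensor T).CommShift₂Int]
    [BIK.IsCompactlyGeneratedTensorTriangulated T]
    {R : Type w} [Ring R] [IsNoetherianRing R] (𝒜 : ℤ → AddSubgroup R) [GradedRing 𝒜]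
    (hcomm : BIK.IsGradedCommutative 𝒜) (hdim : BIK.HasFiniteKrullDim 𝒜)
    (φ : BIK.UnitAction 𝒜 T) (p : BIK.HomogeneousSpec 𝒜) :
    φ.HasLocalCohomology p ∧
    List.TFAE [
      ∀ X : T, (∀ (n : ℤ) (f : ShiftedHom (𝟙_ T) X n), f = 0) → IsZero ((φ.gamma p).obj X),
      BIK.loc (ObjectProperty.singleton ((φ.gamma p).obj (𝟙_ T))) = φ.gammaT p,
      ∀ S : ObjectProperty T, BIK.IsLocalising S → S ≤ φ.gammaT p → BIK.IsTensorIdeal S] := by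
  refine ⟨φ.hasLocalCohomology hcomm hdim p, ?_⟩
  obtain ⟨E, hE, hγ, hloc, hideal, hid⟩ := φ.exists_gamma_iso hcomm hdim p
  have hγT (X : T) : φ.gammaT p (E ⊗ X) := ⟨X, hγ X⟩
  have hL := BIK.isLocalising_loc (ObjectProperty.singleton ((φ.gamma p).obj (𝟙_ T)))
  have hLE : BIK.loc (ObjectProperty.singleton ((φ.gamma p).obj (𝟙_ T))) E :=
    hL.of_iso ((hγ (𝟙_ T)).some ≪≫ ρ_ E) (BIK.mem_loc_singleton _)
  have hle : BIK.loc (ObjectProperty.singleton ((φ.gamma p).obj (𝟙_ T))) ≤ φ.gammaT p :=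
    BIK.loc_singleton_le hloc ⟨_, ⟨Iso.refl _⟩⟩
  tfae_have 1 → 2 := by
    intro h
    refine le_antisymm hle fun X hX => ?_
    obtain ⟨A, B, f, g, k, H, hA, hB⟩ := BIK.exists_triangle_loc_unit X
    have hS := hL.tensorLeft E
    have hEA := hA _ hS (by
      rintro _ ⟨⟩
      exact hL.of_iso (ρ_ E).symm hLE)
    -- Condition 1 applies to `B`, so `E ⊗ X` is built from `E ⊗ A`, which lies in `Loc(E)`.
    have hEB : IsZero (E ⊗ B) := (h B hB).of_iso (hγ B).some.symm
    exact hL.of_iso (hid X hX).some (hS.ext₂ H hEA (hL.zero hEB))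
  tfae_have 2 → 3 := by
    intro h S hS hSγ X Y hX
    have hXS := hS.tensorLeft X
    have hXE := hE _ hXS (by
      rintro _ ⟨⟩
      exact hS.of_iso (ρ_ X).symm hX)
    -- By condition 2, `E ⊗ Y` is built from `E`, and `X ⊗ E` is already in `S`.
    have hXEY : S (X ⊗ E ⊗ Y) := by
      have hEY := hγT Y
      rw [← h] at hEY
      exact BIK.loc_singleton_le hXS (hXS.of_iso ((hγ (𝟙_ T)).some ≪≫ ρ_ E).symm hXE) _ hEY
    exact hS.of_iso (BIK.tensorLeftComm _ _ _ ≪≫ (hid _ (hideal X Y (hSγ X hX))).some) hXEY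
  tfae_have 3 → 2 := by
    intro h
    exact le_antisymm hle fun X hX => hL.of_iso (hid X hX).some (h _ hL hle E X hLE)
  tfae_have 2 → 1 := by
    intro h X hX
    have hEX := hγT X
    rw [← h] at hEX
    refine (BIK.isZero_of_mem_loc_unit (BIK.loc_singleton_le (BIK.isLocalising_loc _)
      ((BIK.isLocalising_loc _).of_iso ((hγ (𝟙_ T)).some ≪≫ ρ_ E).symm hE) _ hEX) ?_).of_iso
      (hγ X).some
    -- As `𝟙` is finitary, the `A` with `Hom^*(𝟙, A ⊗ X) = 0` form a localising subcategory; it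
    -- contains `𝟙`, hence `E`.
    exact hE _ ((BIK.isLocalising_orth_right BIK.isFinitary_unit).tensorRight X) (by
      rintro _ ⟨⟩
      exact BIK.Orth.of_iso_right hX (λ_ X).symm)
  tfae_finish
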